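/- Theorem. Let $k$ be a field of characteristic zero and let $$H=\langle x,y\mid [[y,x],x]=[[y,x],y]=0\rangle$$ be the Heisenberg Lie $k$-algebra, $U(H)$ its universal enveloping algebra, and $\mathfrak{D}(H)$ the Ore division ring of fractions of the Ore domain $U(H)$. The principal involution $*$ on $\mathfrak{D}(H)$ is the unique $k$-linear anti-automorphism of order two with $h^*=-h$ for all $h\in H$. Set $z=[y,x]$, $V=\frac12 z(xy+yx)z$. Then the elements $V-\frac13z^3$, $V+\frac13z^3$, $z+y^2$, $z-y^2$ of $\mathfrak{D}(H)$ are nonzero, and for $$S=\left(V-\tfrac13z^3\right)\left(V+\tfrac13z^3\right)^{-1}+\left(V-\tfrac13z^3\right)^{-1}\left(V+\tfrac13z^3\right),$$ $$T=(z+y^2)^{-1}(z-y^2)\,S\,(z+y^2)(z-y^2)^{-1}$$ the following hold. 1. The $k$-subalgebra of $\mathfrak{D}(H)$ generated by $S$ and $T$ is the free associative $k$-algebra on $\{S,T\}$; that is, the $k$-algebra homomorphism $k\langle X_1,X_2\rangle\to\mathfrak{D}(H)$ with $X_1\mapsto S$, $X_2\mapsto T$ is injective. 2. $S^*=S$ and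 $T^*=T$. -/

import Mathlib

open Polynomial
open scoped nonZeroDivisors

noncomputable section

universe u

/-! ### The Heisenberg Lie algebra -/

/-- The defining relators `⁅⁅y, x⁆, x⁆` and `⁅⁅y, x⁆, y⁆` in the free Lie algebra on the two
letters `x = of 0` and `y = of 1`. -/
def heisenbergRelators (k : Type u) [Field k] : Set (FreeLieAlgebra k (Fin 2)) :=
  {⁅⁅FreeLieAlgebra.of k (1 : Fin 2), FreeLieAlgebra.of k (0 : Fin 2)⁆, FreeLieAlgebra.of k (0 : Fin 2)⁆,
   ⁅⁅FreeLieAlgebra.of k (1 : Fin 2), FreeLieAlgebra.of k (0 : Fin 2)⁆, FreeLieAlgebra.of k (1 : Fin 2)⁆}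

/-- The Heisenberg Lie algebra `⟨x, y | ⁅⁅y, x⁆, x⁆ = ⁅⁅y, x⁆, y⁆ = 0⟩`. -/
abbrev HeisenbergLie (k : Type u) [Field k] : Type u :=
  FreeLieAlgebra k (Fin 2) ⧸
    LieSubmodule.lieSpan k (FreeLieAlgebra k (Fin 2)) (heisenbergRelators k)

namespace HeisenbergLie

/-- The generator `x`. -/
def x (k : Type u) [Field k] : HeisenbergLie k :=
  LieSubmodule.Quotient.mk (FreeLieAlgebra.of k (0 : Fin 2))

/-- The generator `y`. -/
def y (k : Type u) [Field k] : HeisenbergLie k :=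
  LieSubmodule.Quotient.mk (FreeLieAlgebra.of k (1 : Fin 2))

/-- The central element `z = ⁅y, x⁆`. -/
def z (k : Type u) [Field k] : HeisenbergLie k := ⁅y k, x k⁆

theorem lie_z_x (k : Type u) [Field k] : ⁅z k, x k⁆ = 0 := by
  have h : ⁅⁅FreeLieAlgebra.of k (1 : Fin 2), FreeLieAlgebra.of k (0 : Fin 2)⁆, FreeLieAlgebra.of k (0 : Fin 2)⁆ ∈
      LieSubmodule.lieSpan k (FreeLieAlgebra k (Fin 2)) (heisenbergRelators k) :=
    LieSubmodule.subset_lieSpan (Or.inl rfl)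
  exact (LieSubmodule.Quotient.mk_eq_zero (N := LieSubmodule.lieSpan k _ _)).2 h

theorem lie_z_y (k : Type u) [Field k] : ⁅z k, y k⁆ = 0 := by
  have h : ⁅⁅FreeLieAlgebra.of k (1 : Fin 2), FreeLieAlgebra.of k (0 : Fin 2)⁆, FreeLieAlgebra.of k (1 : Fin 2)⁆ ∈
      LieSubmodule.lieSpan k (FreeLieAlgebra k (Fin 2)) (heisenbergRelators k) :=
    LieSubmodule.subset_lieSpan (Or.inr rfl)
  exact (LieSubmodule.Quotient.mk_eq_zero (N := LieSubmodule.lieSpan k _ _)).2 h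

/-- Elements `a, b` of a Lie algebra that satisfy the defining relations receive a homomorphism
that sends `x` to `a` and `y` to `b`. -/
theorem exists_lift {k : Type u} [Field k] {L : Type*} [LieRing L] [LieAlgebra k L] (a b : L)
    (h1 : ⁅⁅b, a⁆, a⁆ = 0) (h2 : ⁅⁅b, a⁆, b⁆ = 0) :
    ∃ f : HeisenbergLie k →ₗ⁅k⁆ L, f (x k) = a ∧ f (y k) = b := by
  let F : FreeLieAlgebra k (Fin 2) →ₗ⁅k⁆ L := FreeLieAlgebra.lift k ![a, b]
  let I : LieIdeal k (FreeLieAlgebra k (Fin 2)) :=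
    LieSubmodule.lieSpan k (FreeLieAlgebra k (Fin 2)) (heisenbergRelators k)
  have hI : I ≤ F.ker := by
    refine LieSubmodule.lieSpan_le.2 ?_
    rintro r (rfl | rfl)
    · change F _ = 0
      rw [LieHom.map_lie, LieHom.map_lie, FreeLieAlgebra.lift_of_apply,
        FreeLieAlgebra.lift_of_apply]
      exact h1
    · change F _ = 0
      rw [LieHom.map_lie, LieHom.map_lie, FreeLieAlgebra.lift_of_apply,
        FreeLieAlgebra.lift_of_apply]
      exact h2
  refine ⟨{ I.toSubmodule.liftQ (F : FreeLieAlgebra k (Fin 2) →ₗ[k] L) (fun r hr => hI hr) with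
    map_lie' := ?_ }, ?_, ?_⟩
  · rintro ⟨r⟩ ⟨s⟩
    exact F.map_lie r s
  · exact (FreeLieAlgebra.lift_of_apply (R := k) ![a, b] 0)
  · exact (FreeLieAlgebra.lift_of_apply (R := k) ![a, b] 1)

/-- `x` and `y` generate the Heisenberg Lie algebra. -/
theorem hom_ext {k : Type u} [Field k] {L : Type*} [LieRing L] [LieAlgebra k L]
    {f g : HeisenbergLie k →ₗ⁅k⁆ L} (hx : f (x k) = g (x k)) (hy : f (y k) = g (y k)) : f = g := by
  let π : FreeLieAlgebra k (Fin 2) →ₗ⁅k⁆ HeisenbergLie k :=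
    { (LieSubmodule.lieSpan k (FreeLieAlgebra k (Fin 2))
        (heisenbergRelators k)).toSubmodule.mkQ with
      map_lie' := fun {r s} => rfl }
  have h : f.comp π = g.comp π := by
    refine FreeLieAlgebra.hom_ext fun i => ?_
    fin_cases i
    · exact hx
    · exact hy
  ext ⟨r⟩
  exact LieHom.congr_fun h r

/-! ### Rings generated by `x`, `y` with `y * x = x * y + z` and `z` central

These facts are used to see that the universal enveloping algebra is an Ore domain. -/

section Basis

/-- Multiplication by `p` on `k[z][x]`. -/
def opM {k : Type*} [Field k] (p : k[X][X]) : Module.End k k[X][X] := LinearMap.mulLeft k p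

/-- The operator `y = z * d/dx` on `k[z][x]`. -/
def opY (k : Type*) [Field k] : Module.End k k[X][X] :=
  opM (C X) * (derivative : k[X][X] →ₗ[k[X]] k[X][X]).restrictScalars k

theorem opM_apply {k : Type*} [Field k] (p q : k[X][X]) : opM p q = p * q := rfl

theorem opY_apply {k : Type*} [Field k] (p : k[X][X]) :
    opY k p = C X * derivative p := rfl

theorem opM_pow {k : Type*} [Field k] (p : k[X][X]) (n : ℕ) : opM p ^ n = opM (p ^ n) :=
  by
  induction n with
  | zero => refine LinearMap.ext fun q => ?_; simp [opM_apply]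
  | succ n ih => refine LinearMap.ext fun q => ?_; rw [pow_succ, ih]; simp [opM_apply, pow_succ, mul_assoc]

theorem opY_opM_X (k : Type*) [Field k] : opY k * opM X = opM X * opY k + opM (C X) := by
  refine LinearMap.ext fun p => ?_
  simp only [Module.End.mul_apply, LinearMap.add_apply, opM_apply, opY_apply, derivative_mul,
    derivative_X]
  ring

theorem opY_pow_apply (k : Type*) [Field k] (c : ℕ) (p : k[X][X]) :
    (opY k ^ c) p = C X ^ c * derivative^[c] p := by
  induction c with
  | zero => simp
  | succ c ih =>
    rw [pow_succ', Module.End.mul_apply, ih, opY_apply, Function.iterate_succ_apply',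
      derivative_mul, ← C_pow, derivative_C, pow_succ]
    simp only [zero_mul, zero_add, C_pow]
    ring

variable {k A : Type*} [Field k] [Ring A] [Algebra k A] {x y z : A}

theorem y_pow_mul_x (hyx : y * x = x * y + z) (hzy : Commute z y) (c : ℕ) :
    y ^ (c + 1) * x = x * y ^ (c + 1) + (c + 1 : ℕ) • (z * y ^ c) := by
  induction c with
  | zero => simp [hyx]
  | succ c ih =>
    rw [pow_succ', mul_assoc, ih, mul_add, ← mul_assoc, hyx, add_mul, mul_assoc, ← pow_succ',
      mul_smul_comm, ← mul_assoc y z, ← hzy.eq, mul_assoc z y, ← pow_succ', add_assoc,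
      succ_nsmul' _ (c + 1)]

/-- The ordered monomials `z ^ a * x ^ b * y ^ c`. -/
def mono (x y z : A) (i : ℕ × ℕ × ℕ) : A := z ^ i.1 * x ^ i.2.1 * y ^ i.2.2

theorem mono_mul_y (i : ℕ × ℕ × ℕ) : mono x y z i * y = mono x y z (i.1, i.2.1, i.2.2 + 1) := by
  simp [mono, mul_assoc, pow_succ]

theorem mono_mul_x_zero (a b : ℕ) : mono x y z (a, b, 0) * x = mono x y z (a, b + 1, 0) := by
  simp [mono, mul_assoc, pow_succ]

theorem mono_mul_x_succ (hyx : y * x = x * y + z) (hzx : Commute z x) (hzy : Commute z y)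
    (a b c : ℕ) : mono x y z (a, b, c + 1) * x =
      mono x y z (a, b + 1, c + 1) + (c + 1 : ℕ) • mono x y z (a + 1, b, c) := by
  simp only [mono]
  rw [mul_assoc, y_pow_mul_x hyx hzy, mul_add, mul_smul_comm, pow_succ x, pow_succ z]
  congr 1
  · simp only [mul_assoc]
  · congr 1
    have h : x ^ b * z = z * x ^ b := ((hzx.pow_right b).eq).symm
    rw [← mul_assoc, mul_assoc (z ^ a) (x ^ b) z, h]
    simp only [mul_assoc]

/-- The span of the ordered monomials all of whose exponents are less than `N`. -/
def box (k : Type*) {A : Type*} [Field k] [Ring A] [Algebra k A] (x y z : A) (N : ℕ) :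
    Submodule k A :=
  Submodule.span k (Set.range fun i : Fin N × Fin N × Fin N => mono x y z (i.1, i.2.1, i.2.2))

theorem mono_mem_box {a b c N : ℕ} (ha : a < N) (hb : b < N) (hc : c < N) :
    mono x y z (a, b, c) ∈ box k x y z N :=
  Submodule.subset_span ⟨(⟨a, ha⟩, ⟨b, hb⟩, ⟨c, hc⟩), rfl⟩

theorem box_mono {M N : ℕ} (h : M ≤ N) : box k x y z M ≤ box k x y z N := by
  refine Submodule.span_le.2 ?_
  rintro _ ⟨i, rfl⟩
  exact mono_mem_box (by omega) (by omega) (by omega)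

theorem box_mul_y {N : ℕ} {p : A} (hp : p ∈ box k x y z N) : p * y ∈ box k x y z (N + 1) := by
  suffices h : box k x y z N ≤ (box k x y z (N + 1)).comap (LinearMap.mulRight k y) from h hp
  refine Submodule.span_le.2 ?_
  rintro _ ⟨⟨a, b, c⟩, rfl⟩
  change mono x y z (a, b, c) * y ∈ box k x y z (N + 1)
  rw [mono_mul_y]
  exact mono_mem_box (a.2.trans (Nat.lt_succ_self N)) (b.2.trans (Nat.lt_succ_self N))
    (Nat.succ_lt_succ c.2)

theorem box_mul_x (hyx : y * x = x * y + z) (hzx : Commute z x) (hzy : Commute z y)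
    {N : ℕ} {p : A} (hp : p ∈ box k x y z N) : p * x ∈ box k x y z (N + 1) := by
  suffices h : box k x y z N ≤ (box k x y z (N + 1)).comap (LinearMap.mulRight k x) from h hp
  refine Submodule.span_le.2 ?_
  rintro _ ⟨⟨a, b, ⟨c, hc⟩⟩, rfl⟩
  change mono x y z (a, b, c) * x ∈ box k x y z (N + 1)
  cases c with
  | zero =>
    rw [mono_mul_x_zero]
    exact mono_mem_box (by omega) (by omega) (by omega)
  | succ c =>
    rw [mono_mul_x_succ hyx hzx hzy]
    exact add_mem (mono_mem_box (by omega) (by omega) (by omega))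
      (nsmul_mem (mono_mem_box (by omega) (by omega) (by omega)) _)

theorem exists_box_mul (hyx : y * x = x * y + z) (hzx : Commute z x) (hzy : Commute z y)
    (hgen : Algebra.adjoin k {x, y} = ⊤) (r : A) :
    ∃ m, ∀ N, ∀ p ∈ box k x y z N, p * r ∈ box k x y z (N + m) := by
  have hr : r ∈ Algebra.adjoin k {x, y} := hgen ▸ Algebra.mem_top
  induction hr using Algebra.adjoin_induction with
  | mem r hr =>
    rcases hr with rfl | rfl
    · exact ⟨1, fun N p hp => box_mul_x hyx hzx hzy hp⟩
    · exact ⟨1, fun N p hp => box_mul_y hp⟩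
  | algebraMap c =>
    refine ⟨0, fun N p hp => ?_⟩
    rw [← Algebra.commutes, ← Algebra.smul_def]
    exact Submodule.smul_mem _ _ hp
  | add r s _ _ hr hs =>
    obtain ⟨m, hm⟩ := hr
    obtain ⟨n, hn⟩ := hs
    refine ⟨m + n, fun N p hp => ?_⟩
    rw [mul_add]
    exact add_mem (box_mono (by omega) (hm N p hp)) (box_mono (by omega) (hn N p hp))
  | mul r s _ _ hr hs =>
    obtain ⟨m, hm⟩ := hr
    obtain ⟨n, hn⟩ := hs
    refine ⟨m + n, fun N p hp => ?_⟩
    rw [← mul_assoc, ← add_assoc]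
    exact hn _ _ (hm N p hp)

theorem span_mono (hyx : y * x = x * y + z) (hzx : Commute z x) (hzy : Commute z y)
    (hgen : Algebra.adjoin k {x, y} = ⊤) : Submodule.span k (Set.range (mono x y z)) = ⊤ := by
  refine eq_top_iff.2 fun r _ => ?_
  obtain ⟨m, hm⟩ := exists_box_mul hyx hzx hzy hgen r
  have h1 : mono x y z (0, 0, 0) ∈ box k x y z 1 := mono_mem_box one_pos one_pos one_pos
  have h := hm 1 _ h1
  rw [mono, pow_zero, pow_zero, pow_zero, one_mul, one_mul, one_mul] at h
  refine Submodule.span_mono ?_ h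
  rintro _ ⟨i, rfl⟩
  exact ⟨_, rfl⟩

theorem mono_op_apply (i : ℕ × ℕ × ℕ) (n : ℕ) :
    mono (opM X) (opY k) (opM (C X)) i (X ^ n) =
      C (C (n.descFactorial i.2.2 : k) * X ^ (i.1 + i.2.2)) * X ^ (i.2.1 + (n - i.2.2)) := by
  simp only [mono, opM_pow, Module.End.mul_apply, opY_pow_apply, opM_apply,
    iterate_derivative_X_pow_eq_natCast_mul, C_mul, C_pow, map_natCast, pow_add]
  ring

theorem op_independent [CharZero k] (s : Finset (ℕ × ℕ × ℕ)) (g : ℕ × ℕ × ℕ → k)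
    (hg : ∑ i ∈ s, g i • mono (opM X) (opY k) (opM (C X)) i = 0) : ∀ i ∈ s, g i = 0 := by
  intro i hi
  by_contra hne
  classical
  let P : ℕ → Prop := fun c => ∃ j ∈ s, g j ≠ 0 ∧ j.2.2 = c
  have hP : ∃ c, P c := ⟨_, i, hi, hne, rfl⟩
  obtain ⟨j, hj, hgj, hjn⟩ := Nat.find_spec hP
  have hmin : ∀ l ∈ s, g l ≠ 0 → j.2.2 ≤ l.2.2 := fun l hl hgl =>
    hjn ▸ Nat.find_min' hP ⟨l, hl, hgl, rfl⟩
  have h := congrArg (fun q : k[X][X] => (q.coeff j.2.1).coeff (j.1 + j.2.2))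
    (congrArg (fun T : Module.End k k[X][X] => T (X ^ j.2.2)) hg)
  simp only [LinearMap.sum_apply, LinearMap.smul_apply, LinearMap.zero_apply, finsetSum_coeff,
    coeff_smul, coeff_zero, mono_op_apply, coeff_C_mul, coeff_X_pow] at h
  rw [Finset.sum_eq_single j] at h
  · have hf : ((j.2.2).factorial : k) ≠ 0 := Nat.cast_ne_zero.2 (Nat.factorial_ne_zero _)
    simp [Nat.descFactorial_self, hgj, hf] at h
  · intro l hl hlj
    by_cases hgl : g l = 0
    · rw [hgl, zero_smul]
    have hle := hmin l hl hgl
    rcases hle.lt_or_eq with hlt | heq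
    · simp [Nat.descFactorial_of_lt hlt]
    · rw [← heq, Nat.sub_self, add_zero]
      by_cases hb : j.2.1 = l.2.1
      · have ha : j.1 ≠ l.1 := fun ha => hlj (by ext <;> simp [ha, hb, heq])
        simp [hb, coeff_X_pow, ha]
      · simp [hb]
  · exact fun h => absurd hj h

theorem map_mono (ρ : A →ₐ[k] Module.End k k[X][X])
    (hx : ρ x = opM X) (hy : ρ y = opY k) (hz : ρ z = opM (C X)) (i : ℕ × ℕ × ℕ) :
    ρ (mono x y z i) = mono (opM X) (opY k) (opM (C X)) i := by
  simp only [mono, map_mul, map_pow, hx, hy, hz]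

theorem linearIndependent_mono [CharZero k] (ρ : A →ₐ[k] Module.End k k[X][X])
    (hx : ρ x = opM X) (hy : ρ y = opY k) (hz : ρ z = opM (C X)) :
    LinearIndependent k (mono x y z) := by
  rw [linearIndependent_iff']
  intro s g hg
  refine op_independent s g ?_
  have h := congrArg ρ hg
  simpa only [map_sum, map_smul, map_zero, map_mono ρ hx hy hz] using h

theorem rep_injective [CharZero k] (hyx : y * x = x * y + z) (hzx : Commute z x)
    (hzy : Commute z y) (hgen : Algebra.adjoin k {x, y} = ⊤)
    (ρ : A →ₐ[k] Module.End k k[X][X])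
    (hx : ρ x = opM X) (hy : ρ y = opY k) (hz : ρ z = opM (C X)) :
    Function.Injective ρ := by
  refine (injective_iff_map_eq_zero ρ).2 fun p hp => ?_
  have h : p ∈ Submodule.span k (Set.range (mono x y z)) :=
    span_mono hyx hzx hzy hgen ▸ Submodule.mem_top
  obtain ⟨g, rfl⟩ := (Finsupp.mem_span_range_iff_exists_finsupp).1 h
  rw [Finsupp.sum] at hp ⊢
  simp only [map_sum, map_smul, map_mono ρ hx hy hz] at hp
  refine Finset.sum_eq_zero fun i hi => ?_
  rw [op_independent _ _ hp i hi, zero_smul]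

/-- The commutator with `x`. -/
def ad (k : Type*) {A : Type*} [Field k] [Ring A] [Algebra k A] (x : A) : A →ₗ[k] A :=
  LinearMap.mulRight k x - LinearMap.mulLeft k x

theorem ad_apply (x p : A) : ad k x p = p * x - x * p := rfl

theorem ad_mul (x p q : A) : ad k x (p * q) = ad k x p * q + p * ad k x q := by
  simp only [ad_apply, sub_mul, mul_sub, mul_assoc]
  abel

theorem ad_pow_mul (x : A) (m n : ℕ) : ∀ p q : A, (ad k x ^ (m + 1)) p = 0 →
    (ad k x ^ (n + 1)) q = 0 →
    (ad k x ^ (m + n)) (p * q) = (m + n).choose m • ((ad k x ^ m) p * (ad k x ^ n) q) := by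
  induction hN : m + n generalizing m n with
  | zero =>
    obtain ⟨rfl, rfl⟩ : m = 0 ∧ n = 0 := by omega
    intro p q _ _
    simp
  | succ N ih =>
    intro p q hp hq
    rw [pow_succ, Module.End.mul_apply, ad_mul, map_add]
    have h1 : (ad k x ^ N) (ad k x p * q) =
        if m = 0 then 0 else N.choose (m - 1) • ((ad k x ^ m) p * (ad k x ^ n) q) := by
      cases m with
      | zero =>
        have : ad k x p = 0 := by simpa using hp
        simp [this]
      | succ m =>
        rw [ih m n (by omega) _ _ (by rwa [pow_succ] at hp) hq]
        simp [pow_succ]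
    have h2 : (ad k x ^ N) (p * ad k x q) =
        if n = 0 then 0 else N.choose m • ((ad k x ^ m) p * (ad k x ^ n) q) := by
      cases n with
      | zero =>
        have : ad k x q = 0 := by simpa using hq
        simp [this]
      | succ n =>
        rw [ih m n (by omega) _ _ hp (by rwa [pow_succ] at hq)]
        simp [pow_succ]
    rw [h1, h2]
    rcases Nat.eq_zero_or_pos m with rfl | hm
    · have : n ≠ 0 := by omega
      simp [this]
    · obtain ⟨m, rfl⟩ : ∃ l, m = l + 1 := ⟨m - 1, by omega⟩
      rcases Nat.eq_zero_or_pos n with rfl | hn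
      · obtain rfl : m = N := by omega
        simp
      · simp only [Nat.add_eq_zero_iff, one_ne_zero, and_false, if_false, hn.ne',
          Nat.add_sub_cancel, ← add_smul]
        rw [Nat.choose_succ_succ]

theorem exists_ad_pow_eq_zero (hyx : y * x = x * y + z) (hzx : Commute z x) (hzy : Commute z y)
    (hgen : Algebra.adjoin k {x, y} = ⊤) (p : A) : ∃ n, (ad k x ^ n) p = 0 := by
  have hp : p ∈ Submodule.span k (Set.range (mono x y z)) :=
    span_mono hyx hzx hzy hgen ▸ Submodule.mem_top
  have hup : ∀ {m n : ℕ} {q : A}, m ≤ n → (ad k x ^ m) q = 0 → (ad k x ^ n) q = 0 := by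
    intro m n q hmn hq
    obtain ⟨l, rfl⟩ := Nat.exists_eq_add_of_le' hmn
    rw [pow_add, Module.End.mul_apply, hq, map_zero]
  induction hp using Submodule.span_induction with
  | mem q hq =>
    obtain ⟨⟨a, b, c⟩, rfl⟩ := hq
    refine ⟨c + 1, ?_⟩
    have hxm : ∀ a b c, x * mono x y z (a, b, c) = mono x y z (a, b + 1, c) := by
      intro a b c
      simp only [mono]
      rw [← mul_assoc, ← mul_assoc, ← (hzx.pow_left a).eq, mul_assoc (z ^ a), ← pow_succ']
    induction c generalizing a with
    | zero =>
      simp [ad_apply, mono_mul_x_zero, hxm]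
    | succ c ih =>
      rw [pow_succ, Module.End.mul_apply, ad_apply, mono_mul_x_succ hyx hzx hzy, hxm,
        add_sub_cancel_left, map_nsmul, ih, smul_zero]
  | zero => exact ⟨0, by simp⟩
  | add q r _ _ hq hr =>
    obtain ⟨m, hm⟩ := hq
    obtain ⟨n, hn⟩ := hr
    exact ⟨m + n, by rw [map_add, hup (by omega) hm, hup (by omega) hn, add_zero]⟩
  | smul c q _ hq =>
    obtain ⟨m, hm⟩ := hq
    exact ⟨m, by rw [map_smul, hm, smul_zero]⟩

/-- An operator on `k[z][x]` that commutes with multiplication by `x` and by `z` is a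
multiplication. -/
theorem eq_opM (T : Module.End k k[X][X]) (hX : T * opM X = opM X * T)
    (hC : T * opM (C X) = opM (C X) * T) : T = opM (T 1) := by
  have hX' : ∀ q, T (X * q) = X * T q := fun q => congrArg (fun S : Module.End k k[X][X] => S q) hX
  have hC' : ∀ q, T (C X * q) = C X * T q :=
    fun q => congrArg (fun S : Module.End k k[X][X] => S q) hC
  have hc : ∀ (c : k) (q : k[X][X]), C (C c) * q = c • q := by
    intro c q
    rw [← smul_eq_C_mul]
    ext
    simp
  have h1 : ∀ (a : k[X]) (q : k[X][X]), T (C a * q) = C a * T q := by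
    intro a
    induction a using Polynomial.induction_on with
    | C c => intro q; rw [hc, hc, map_smul]
    | add a b ha hb => intro q; rw [C_add, add_mul, map_add, ha, hb, add_mul]
    | monomial n c ih =>
      intro q
      rw [pow_succ, ← mul_assoc, C_mul, mul_assoc, ih, hC', mul_assoc]
  refine LinearMap.ext fun q => ?_
  rw [opM_apply]
  induction q using Polynomial.induction_on with
  | C a => simpa [mul_comm] using h1 a 1
  | add p q hp hq => rw [map_add, hp, hq, mul_add]
  | monomial n a ih =>
    rw [pow_succ', mul_left_comm, hX', ih]
    ring

theorem noZeroDivisors [CharZero k] (hyx : y * x = x * y + z) (hzx : Commute z x)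
    (hzy : Commute z y) (hgen : Algebra.adjoin k {x, y} = ⊤)
    (ρ : A →ₐ[k] Module.End k k[X][X])
    (hx : ρ x = opM X) (hy : ρ y = opY k) (hz : ρ z = opM (C X)) :
    NoZeroDivisors A := by
  have hinj := rep_injective hyx hzx hzy hgen ρ hx hy hz
  have hzc : ∀ p, Commute z p := by
    intro p
    have hp : p ∈ Algebra.adjoin k {x, y} := hgen ▸ Algebra.mem_top
    induction hp using Algebra.adjoin_induction with
    | mem p hp => rcases hp with rfl | rfl <;> assumption
    | algebraMap c => exact (Algebra.commutes c z).symm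
    | add p q _ _ hp hq => exact hp.add_right hq
    | mul p q _ _ hp hq => exact hp.mul_right hq
  have hop : ∀ p, ad k x p = 0 → ρ p = opM (ρ p 1) := by
    intro p hp
    refine eq_opM _ ?_ ?_
    · rw [← hx, ← map_mul, ← map_mul]
      exact congrArg ρ (sub_eq_zero.1 hp)
    · rw [← hz, ← map_mul, ← map_mul, (hzc p).eq]
  have hlead : ∀ p : A, p ≠ 0 → ∃ n, (ad k x ^ n) p ≠ 0 ∧ (ad k x ^ (n + 1)) p = 0 := by
    intro p hp
    classical
    have h := exists_ad_pow_eq_zero hyx hzx hzy hgen p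
    have h0 : Nat.find h ≠ 0 := fun h0 => hp (by simpa [h0] using Nat.find_spec h)
    refine ⟨Nat.find h - 1, Nat.find_min h (by omega), ?_⟩
    rw [Nat.sub_add_cancel (Nat.pos_of_ne_zero h0)]
    exact Nat.find_spec h
  refine ⟨fun {p q} hpq => ?_⟩
  by_contra! hne
  obtain ⟨m, hm0, hm⟩ := hlead p hne.1
  obtain ⟨n, hn0, hn⟩ := hlead q hne.2
  have key := ad_pow_mul x m n p q hm hn
  rw [hpq, map_zero, eq_comm, ← Nat.cast_smul_eq_nsmul k, smul_eq_zero] at key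
  have hch : ((m + n).choose m : k) ≠ 0 := Nat.cast_ne_zero.2 (Nat.choose_pos (by omega)).ne'
  have key := key.resolve_left hch
  have hm' := hop _ (by rwa [pow_succ', Module.End.mul_apply] at hm)
  have hn' := hop _ (by rwa [pow_succ', Module.End.mul_apply] at hn)
  have h1 := congrArg (fun T : Module.End k k[X][X] => T 1) (congrArg ρ key)
  simp only [map_mul, map_zero, Module.End.mul_apply, LinearMap.zero_apply] at h1
  rw [hm', opM_apply] at h1
  rcases mul_eq_zero.1 h1 with h | h
  · refine hm0 (hinj ?_)
    rw [hm', h, map_zero]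
    exact LinearMap.ext fun q => zero_mul q
  · refine hn0 (hinj ?_)
    rw [hn', h, map_zero]
    exact LinearMap.ext fun q => zero_mul q

theorem exists_ore [CharZero k] (hyx : y * x = x * y + z) (hzx : Commute z x)
    (hzy : Commute z y) (hgen : Algebra.adjoin k {x, y} = ⊤)
    (ρ : A →ₐ[k] Module.End k k[X][X])
    (hx : ρ x = opM X) (hy : ρ y = opY k) (hz : ρ z = opM (C X)) (r s : A) (hs : s ≠ 0) :
    ∃ r' s' : A, s' ≠ 0 ∧ s' * r = r' * s := by
  have := noZeroDivisors hyx hzx hzy hgen ρ hx hy hz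
  obtain ⟨m₁, hm₁⟩ := exists_box_mul hyx hzx hzy hgen r
  obtain ⟨m₂, hm₂⟩ := exists_box_mul hyx hzx hzy hgen s
  let m := m₁ + m₂ + 1
  let N := 4 * m
  have hfin : ∀ N, FiniteDimensional k (box k x y z N) := fun N =>
    FiniteDimensional.span_of_finite k (Set.finite_range _)
  have hrank : ∀ N, Module.finrank k (box k x y z N) = N * (N * N) := by
    intro N
    have hli : LinearIndependent k
        (fun i : Fin N × Fin N × Fin N => mono x y z (i.1, i.2.1, i.2.2)) := by
      refine (linearIndependent_mono ρ hx hy hz).comp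
        (fun i : Fin N × Fin N × Fin N => ((i.1 : ℕ), (i.2.1 : ℕ), (i.2.2 : ℕ))) ?_
      rintro ⟨a, b, c⟩ ⟨a', b', c'⟩ h
      simpa [Fin.ext_iff] using h
    rw [box, finrank_span_eq_card hli]
    simp
  let f : (box k x y z N × box k x y z N) →ₗ[k] box k x y z (N + m) :=
    LinearMap.codRestrict _ ((LinearMap.mulRight k r).comp
        ((box k x y z N).subtype.comp (LinearMap.fst k _ _)) -
      (LinearMap.mulRight k s).comp ((box k x y z N).subtype.comp (LinearMap.snd k _ _)))
      (fun v => sub_mem (box_mono (by omega) (hm₁ N _ v.1.2)) (box_mono (by omega) (hm₂ N _ v.2.2)))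
  have hker : LinearMap.ker f ≠ ⊥ := by
    refine LinearMap.ker_ne_bot_of_finrank_lt ?_
    rw [Module.finrank_prod, hrank, hrank]
    have : 0 < m := by omega
    have : 0 < m * (m * m) := by positivity
    simp only [N]
    nlinarith
  obtain ⟨⟨p, q⟩, hpq, hne⟩ := (Submodule.ne_bot_iff _).1 hker
  have h : (p : A) * r = q * s := sub_eq_zero.1 (congrArg Subtype.val (LinearMap.mem_ker.1 hpq))
  refine ⟨q, p, fun hp => hne ?_, h⟩
  rw [hp, zero_mul, eq_comm, mul_eq_zero] at h
  have hq := h.resolve_right hs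
  ext <;> simp [hp, hq]

end Basis

end HeisenbergLie

/-! ### The universal enveloping algebra and its Ore division ring of fractions -/

/-- The universal enveloping algebra `U(H)` of the Heisenberg Lie algebra. -/
abbrev HeisenbergU (k : Type u) [Field k] : Type u := UniversalEnvelopingAlgebra k (HeisenbergLie k)

namespace HeisenbergU

section

attribute [local instance] LieRing.ofAssociativeRing

/-- The canonical map `H → U(H)`. -/
def ofLie {k : Type u} [Field k] : HeisenbergLie k →ₗ[k] HeisenbergU k :=
  (UniversalEnvelopingAlgebra.ι k : HeisenbergLie k →ₗ⁅k⁆ HeisenbergU k)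

theorem ofLie_lie {k : Type u} [Field k] (a b : HeisenbergLie k) :
    ofLie ⁅a, b⁆ = ofLie a * ofLie b - ofLie b * ofLie a :=
  LieHom.map_lie (UniversalEnvelopingAlgebra.ι k) a b

/-- The universal property of `U(H)`. -/
theorem exists_lift {k : Type u} [Field k] {A : Type*} [Ring A] [Algebra k A]
    (f : HeisenbergLie k →ₗ[k] A) (hf : ∀ a b, f ⁅a, b⁆ = f a * f b - f b * f a) :
    ∃ F : HeisenbergU k →ₐ[k] A, ∀ a, F (ofLie a) = f a :=
  ⟨UniversalEnvelopingAlgebra.lift k { f with map_lie' := fun {a b} => hf a b },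
    fun a => UniversalEnvelopingAlgebra.lift_ι_apply k _ a⟩

theorem hom_ext {k : Type u} [Field k] {A : Type*} [Ring A] [Algebra k A]
    {F G : HeisenbergU k →ₐ[k] A} (h : ∀ a, F (ofLie a) = G (ofLie a)) : F = G :=
  UniversalEnvelopingAlgebra.hom_ext k (LieHom.ext h)

/-- The principal involution of `U(H)`, as a homomorphism to the opposite algebra: the extension
of `h ↦ -h`. -/
def principalInvolution (k : Type u) [Field k] : HeisenbergU k →ₐ[k] (HeisenbergU k)ᵐᵒᵖ :=
  UniversalEnvelopingAlgebra.lift k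
    { toFun := fun h => MulOpposite.op (-ofLie h)
      map_add' := fun a b => by rw [map_add, neg_add, MulOpposite.op_add]
      map_smul' := fun c a => by rw [map_smul, ← smul_neg, MulOpposite.op_smul, RingHom.id_apply]
      map_lie' := fun {a b} => by
        rw [ofLie_lie, LieRing.of_associative_ring_bracket, ← MulOpposite.op_mul,
          ← MulOpposite.op_mul, ← MulOpposite.op_sub, neg_mul_neg, neg_mul_neg, neg_sub] }

theorem principalInvolution_ofLie {k : Type u} [Field k] (h : HeisenbergLie k) :
    principalInvolution k (ofLie h) = MulOpposite.op (-ofLie h) :=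
  UniversalEnvelopingAlgebra.lift_ι_apply k _ h

theorem principalInvolution_involutive {k : Type u} [Field k] (u : HeisenbergU k) :
    (principalInvolution k (principalInvolution k u).unop).unop = u := by
  let F : HeisenbergU k →ₐ[k] HeisenbergU k :=
    (AlgEquiv.opOp k (HeisenbergU k)).symm.toAlgHom.comp
      ((AlgHom.op (principalInvolution k)).comp (principalInvolution k))
  have h : F = AlgHom.id k _ := by
    refine hom_ext fun a => ?_
    change (principalInvolution k (principalInvolution k (ofLie a)).unop).unop = ofLie a
    rw [principalInvolution_ofLie, MulOpposite.unop_op, map_neg, principalInvolution_ofLie,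
      MulOpposite.unop_neg, MulOpposite.unop_op, neg_neg]
  exact congrArg (fun G : HeisenbergU k →ₐ[k] HeisenbergU k => G u) h

theorem exists_rep (k : Type u) [Field k] :
    ∃ ρ : HeisenbergU k →ₐ[k] Module.End k k[X][X],
      ρ (ofLie (HeisenbergLie.x k)) = HeisenbergLie.opM X ∧
      ρ (ofLie (HeisenbergLie.y k)) = HeisenbergLie.opY k := by
  have hbr : ⁅HeisenbergLie.opY k, HeisenbergLie.opM X⁆ = HeisenbergLie.opM (C X : k[X][X]) := by
    change HeisenbergLie.opY k * HeisenbergLie.opM X - HeisenbergLie.opM X * HeisenbergLie.opY k = _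
    rw [HeisenbergLie.opY_opM_X]
    exact add_sub_cancel_left (HeisenbergLie.opM X * HeisenbergLie.opY k) _
  obtain ⟨f, hfx, hfy⟩ := HeisenbergLie.exists_lift (k := k)
    (L := Module.End k k[X][X]) (HeisenbergLie.opM X) (HeisenbergLie.opY k)
    (by
      rw [hbr, LieRing.of_associative_ring_bracket, sub_eq_zero]
      refine LinearMap.ext fun p => ?_
      exact mul_left_comm _ _ _)
    (by
      rw [hbr, LieRing.of_associative_ring_bracket, sub_eq_zero]
      refine LinearMap.ext fun p => ?_
      simp only [Module.End.mul_apply, HeisenbergLie.opM_apply, HeisenbergLie.opY_apply,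
        Polynomial.derivative_mul, Polynomial.derivative_C, zero_mul, zero_add])
  refine ⟨UniversalEnvelopingAlgebra.lift k f, ?_, ?_⟩
  · rw [← hfx]
    exact UniversalEnvelopingAlgebra.lift_ι_apply k f _
  · rw [← hfy]
    exact UniversalEnvelopingAlgebra.lift_ι_apply k f _

theorem adjoin_eq_top (k : Type u) [Field k] :
    Algebra.adjoin k {(ofLie (HeisenbergLie.x k) : HeisenbergU k), ofLie (HeisenbergLie.y k)} =
      (⊤ : Subalgebra k (HeisenbergU k)) := by
  let B := Algebra.adjoin k
    {(ofLie (HeisenbergLie.x k) : HeisenbergU k), ofLie (HeisenbergLie.y k)}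
  have hx : ofLie (HeisenbergLie.x k) ∈ B := Algebra.subset_adjoin (Or.inl rfl)
  have hy : ofLie (HeisenbergLie.y k) ∈ B := Algebra.subset_adjoin (Or.inr rfl)
  have hz : ofLie (HeisenbergLie.z k) ∈ B := by
    rw [HeisenbergLie.z, ofLie_lie]
    exact sub_mem (mul_mem hy hx) (mul_mem hx hy)
  have hzx := congrArg ofLie (HeisenbergLie.lie_z_x k)
  have hzy := congrArg ofLie (HeisenbergLie.lie_z_y k)
  rw [ofLie_lie, map_zero] at hzx hzy
  obtain ⟨f, hfx, hfy⟩ := HeisenbergLie.exists_lift (k := k) (L := B)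
    ⟨_, hx⟩ ⟨_, hy⟩
    (by
      refine Subtype.ext ?_
      simp only [LieRing.of_associative_ring_bracket]
      rw [HeisenbergLie.z, ofLie_lie] at hzx
      exact hzx)
    (by
      refine Subtype.ext ?_
      simp only [LieRing.of_associative_ring_bracket]
      rw [HeisenbergLie.z, ofLie_lie] at hzy
      exact hzy)
  let F : HeisenbergU k →ₐ[k] B := UniversalEnvelopingAlgebra.lift k f
  have hF : ∀ a, F (ofLie a) = f a := fun a => UniversalEnvelopingAlgebra.lift_ι_apply k f a
  have hcomp : B.val.comp F = AlgHom.id k _ := by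
    let G : HeisenbergU k →ₐ[k] HeisenbergU k := B.val.comp F
    have h : (G : HeisenbergU k →ₗ⁅k⁆ HeisenbergU k).comp (UniversalEnvelopingAlgebra.ι k) =
        UniversalEnvelopingAlgebra.ι k := by
      refine HeisenbergLie.hom_ext ?_ ?_
      · exact congrArg Subtype.val ((hF _).trans hfx)
      · exact congrArg Subtype.val ((hF _).trans hfy)
    exact hom_ext fun a => LieHom.congr_fun h a
  refine eq_top_iff.2 fun p _ => ?_
  have h := congrArg (fun φ : HeisenbergU k →ₐ[k] HeisenbergU k => φ p) hcomp
  have h : ((F p : B) : HeisenbergU k) = p := h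
  rw [← h]
  exact (F p).2

end

theorem y_mul_x (k : Type u) [Field k] :
    (ofLie (HeisenbergLie.y k) * ofLie (HeisenbergLie.x k) : HeisenbergU k) =
      ofLie (HeisenbergLie.x k) * ofLie (HeisenbergLie.y k) + ofLie (HeisenbergLie.z k) := by
  rw [HeisenbergLie.z, ofLie_lie]
  abel

theorem commute_z_x (k : Type u) [Field k] :
    Commute (ofLie (HeisenbergLie.z k)) (ofLie (HeisenbergLie.x k) : HeisenbergU k) := by
  have h := congrArg ofLie (HeisenbergLie.lie_z_x k)
  rwa [ofLie_lie, map_zero, sub_eq_zero] at h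

theorem commute_z_y (k : Type u) [Field k] :
    Commute (ofLie (HeisenbergLie.z k)) (ofLie (HeisenbergLie.y k) : HeisenbergU k) := by
  have h := congrArg ofLie (HeisenbergLie.lie_z_y k)
  rwa [ofLie_lie, map_zero, sub_eq_zero] at h

theorem exists_rep' (k : Type u) [Field k] :
    ∃ ρ : HeisenbergU k →ₐ[k] Module.End k k[X][X],
      ρ (ofLie (HeisenbergLie.x k)) = HeisenbergLie.opM X ∧
      ρ (ofLie (HeisenbergLie.y k)) = HeisenbergLie.opY k ∧
      ρ (ofLie (HeisenbergLie.z k)) = HeisenbergLie.opM (C X) := by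
  obtain ⟨ρ, hx, hy⟩ := exists_rep k
  refine ⟨ρ, hx, hy, ?_⟩
  rw [HeisenbergLie.z, ofLie_lie, map_sub, map_mul, map_mul, hx, hy, HeisenbergLie.opY_opM_X]
  exact add_sub_cancel_left (HeisenbergLie.opM X * HeisenbergLie.opY k) (HeisenbergLie.opM (C X))

instance instNontrivial (k : Type u) [Field k] : Nontrivial (HeisenbergU k) := by
  obtain ⟨ρ, -⟩ := exists_rep k
  exact ρ.toRingHom.domain_nontrivial

instance instNoZeroDivisors (k : Type u) [Field k] [CharZero k] :
    NoZeroDivisors (HeisenbergU k) := by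
  obtain ⟨ρ, hx, hy, hz⟩ := exists_rep' k
  exact HeisenbergLie.noZeroDivisors (y_mul_x k) (commute_z_x k) (commute_z_y k)
    (adjoin_eq_top k) ρ hx hy hz

/-- `U(H)` is a (left) Ore domain: for `r` and `s ≠ 0` there are `r'` and `s' ≠ 0` with
`s' * r = r' * s`. -/
theorem nonempty_oreSet (k : Type u) [Field k] [CharZero k] :
    Nonempty (OreLocalization.OreSet (HeisenbergU k)⁰) := by
  obtain ⟨ρ, hx, hy, hz⟩ := exists_rep' k
  refine OreLocalization.nonempty_oreSet_iff_of_noZeroDivisors.2 fun r s => ?_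
  obtain ⟨r', s', hs', h⟩ := HeisenbergLie.exists_ore (y_mul_x k) (commute_z_x k)
    (commute_z_y k) (adjoin_eq_top k) ρ hx hy hz r s (nonZeroDivisors.coe_ne_zero s)
  exact ⟨r', ⟨s', mem_nonZeroDivisors_of_ne_zero hs'⟩, h⟩

instance instOreSet (k : Type u) [Field k] [CharZero k] :
    OreLocalization.OreSet (HeisenbergU k)⁰ := (nonempty_oreSet k).some

end HeisenbergU

/-- The Ore division ring of fractions `𝔇(H)` of `U(H)`. -/
abbrev HeisenbergD (k : Type u) [Field k] [CharZero k] : Type u :=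
  OreLocalization (HeisenbergU k)⁰ (HeisenbergU k)

namespace HeisenbergD

variable (k : Type u) [Field k] [CharZero k]

/-- The embedding `U(H) → 𝔇(H)`. -/
def ofU : HeisenbergU k →ₐ[k] HeisenbergD k :=
  { (OreLocalization.numeratorRingHom : HeisenbergU k →+* HeisenbergD k) with
    commutes' := fun _ => rfl }

theorem ofU_injective : Function.Injective (ofU k) :=
  OreLocalization.numeratorHom_inj inf_le_left

theorem ofU_ne_zero (s : (HeisenbergU k)⁰) : ofU k s ≠ 0 :=
  (map_ne_zero_iff _ (ofU_injective k)).2 (nonZeroDivisors.coe_ne_zero s)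

/-- Every element of `𝔇(H)` is a fraction `s⁻¹ r` with `r, s ∈ U(H)`, `s ≠ 0`. -/
theorem exists_eq_inv_mul (d : HeisenbergD k) :
    ∃ r s : HeisenbergU k, s ≠ 0 ∧ d = (ofU k s)⁻¹ * ofU k r := by
  induction d using OreLocalization.ind with
  | _ r s =>
    refine ⟨r, s, nonZeroDivisors.coe_ne_zero s, ?_⟩
    rw [eq_inv_mul_iff_mul_eq₀ (ofU_ne_zero k s)]
    exact OreLocalization.mul_cancel

variable {k} in
/-- Ring homomorphisms out of `𝔇(H)` are determined on `U(H)`. -/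
theorem hom_ext {T : Type*} [DivisionRing T] {F G : HeisenbergD k →+* T}
    (h : ∀ u, F (ofU k u) = G (ofU k u)) : F = G := by
  refine RingHom.ext fun d => ?_
  obtain ⟨r, s, -, rfl⟩ := exists_eq_inv_mul k d
  rw [map_mul, map_mul, map_inv₀, map_inv₀, h, h]

/-- The composite of the principal involution of `U(H)` with `U(H) → 𝔇(H)`. -/
def involutionAux : HeisenbergU k →ₐ[k] (HeisenbergD k)ᵐᵒᵖ :=
  (AlgHom.op (ofU k)).comp (HeisenbergU.principalInvolution k)

theorem involutionAux_apply (u : HeisenbergU k) :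
    involutionAux k u = MulOpposite.op (ofU k (HeisenbergU.principalInvolution k u).unop) := rfl

theorem isUnit_involutionAux (s : (HeisenbergU k)⁰) : IsUnit (involutionAux k s) := by
  refine isUnit_iff_ne_zero.2 fun h => nonZeroDivisors.coe_ne_zero s ?_
  rw [involutionAux_apply, MulOpposite.op_eq_zero_iff, map_eq_zero_iff _ (ofU_injective k)] at h
  rw [← HeisenbergU.principalInvolution_involutive (s : HeisenbergU k), h, map_zero,
    MulOpposite.unop_zero]

/-- The principal involution of `𝔇(H)`, as a homomorphism of `k`-algebras to the opposite algebra: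
the extension of the principal involution of `U(H)` to fractions. -/
def principalInvolution : HeisenbergD k →ₐ[k] (HeisenbergD k)ᵐᵒᵖ :=
  { OreLocalization.universalHom (involutionAux k : HeisenbergU k →+* (HeisenbergD k)ᵐᵒᵖ)
      (IsUnit.liftRight (((involutionAux k : HeisenbergU k →* (HeisenbergD k)ᵐᵒᵖ)).comp
        (HeisenbergU k)⁰.subtype) (isUnit_involutionAux k)) (fun _ => rfl) with
    commutes' := fun c => by
      refine (OreLocalization.universalHom_commutes _ _ _).trans ?_
      exact (involutionAux k).commutes c }

theorem principalInvolution_ofU (u : HeisenbergU k) :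
    principalInvolution k (ofU k u) =
      MulOpposite.op (ofU k (HeisenbergU.principalInvolution k u).unop) :=
  OreLocalization.universalHom_commutes _ _ _

/-- The principal involution extends `h ↦ -h` on the Heisenberg Lie algebra. -/
theorem principalInvolution_ofLie (h : HeisenbergLie k) :
    principalInvolution k (ofU k (HeisenbergU.ofLie h)) =
      MulOpposite.op (-ofU k (HeisenbergU.ofLie h)) := by
  rw [principalInvolution_ofU, HeisenbergU.principalInvolution_ofLie, MulOpposite.unop_op, map_neg]

/-- The principal involution is an involution: `d ** = d`. -/
theorem principalInvolution_involutive (d : HeisenbergD k) :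
    (principalInvolution k (principalInvolution k d).unop).unop = d := by
  let F : HeisenbergD k →+* HeisenbergD k :=
    ((AlgEquiv.opOp k (HeisenbergD k)).symm.toAlgHom.comp
      ((AlgHom.op (principalInvolution k)).comp (principalInvolution k))).toRingHom
  have h : F = RingHom.id _ := by
    refine hom_ext fun u => ?_
    change (principalInvolution k (principalInvolution k (ofU k u)).unop).unop = ofU k u
    rw [principalInvolution_ofU, MulOpposite.unop_op, principalInvolution_ofU,
      MulOpposite.unop_op, HeisenbergU.principalInvolution_involutive]
  exact congrArg (fun G : HeisenbergD k →+* HeisenbergD k => G d) h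

/-- The principal involution is the only `k`-linear anti-homomorphism of `𝔇(H)` that extends
`h ↦ -h`. -/
theorem principalInvolution_unique (F : HeisenbergD k →ₐ[k] (HeisenbergD k)ᵐᵒᵖ)
    (hF : ∀ h, F (ofU k (HeisenbergU.ofLie h)) = MulOpposite.op (-ofU k (HeisenbergU.ofLie h))) :
    F = principalInvolution k := by
  have h : F.comp (ofU k) = (principalInvolution k).comp (ofU k) :=
    HeisenbergU.hom_ext fun a => (hF a).trans (principalInvolution_ofLie k a).symm
  refine AlgHom.coe_ringHom_injective (hom_ext fun u => ?_)
  exact congrArg (fun G : HeisenbergU k →ₐ[k] (HeisenbergD k)ᵐᵒᵖ => G u) h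

/-- Every element of `𝔇(H)` is also a right fraction `r s⁻¹`. -/
theorem exists_eq_mul_inv (d : HeisenbergD k) :
    ∃ r s : HeisenbergU k, s ≠ 0 ∧ d = ofU k r * (ofU k s)⁻¹ := by
  obtain ⟨r, s, hs, h⟩ := exists_eq_inv_mul k (principalInvolution k d).unop
  refine ⟨(HeisenbergU.principalInvolution k r).unop,
    (HeisenbergU.principalInvolution k s).unop, fun h0 => hs ?_, ?_⟩
  · rw [← HeisenbergU.principalInvolution_involutive s, h0, map_zero, MulOpposite.unop_zero]
  · rw [← principalInvolution_involutive k d, h, map_mul, map_inv₀, principalInvolution_ofU,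
      principalInvolution_ofU, MulOpposite.unop_mul, MulOpposite.unop_inv, MulOpposite.unop_op,
      MulOpposite.unop_op]

/-- The image of `y` in `𝔇(H)`. -/
def y : HeisenbergD k := ofU k (HeisenbergU.ofLie (HeisenbergLie.y k))

/-- The image of `x` in `𝔇(H)`. -/
def x : HeisenbergD k := ofU k (HeisenbergU.ofLie (HeisenbergLie.x k))

/-- The image of `z = ⁅y, x⁆` in `𝔇(H)`. -/
def z : HeisenbergD k := ofU k (HeisenbergU.ofLie (HeisenbergLie.z k))

/-- `V = (1/2) z (x y + y x) z`. -/
def V : HeisenbergD k := (1 / 2 : k) • (z k * (x k * y k + y k * x k) * z k)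

/-- `S = (V - z³/3) (V + z³/3)⁻¹ + (V - z³/3)⁻¹ (V + z³/3)`. -/
def S : HeisenbergD k :=
  (V k - (1 / 3 : k) • z k ^ 3) * (V k + (1 / 3 : k) • z k ^ 3)⁻¹ +
    (V k - (1 / 3 : k) • z k ^ 3)⁻¹ * (V k + (1 / 3 : k) • z k ^ 3)

/-- `T = (z + y²)⁻¹ (z - y²) S (z + y²) (z - y²)⁻¹`. -/
def T : HeisenbergD k :=
  (z k + y k ^ 2)⁻¹ * (z k - y k ^ 2) * S k * (z k + y k ^ 2) * (z k - y k ^ 2)⁻¹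

end HeisenbergD

end

/-!
Let `τ` be the automorphism `t ↦ t + 1` of the field `K = k(z)(t)`. The algebra `U(H)` acts on the
Laurent series in `y` with coefficients in `K`, where `y r = τ(r) y` for `r ∈ K` and `x` acts as
`z (t - 1/2) y⁻¹`. A nonzero element of `U(H)` acts as a nonzero skew Laurent polynomial, which is
bijective because Laurent series are complete (`HasLeadingTerm.isUnit`, `isUnit_laurentRep`), so the
action extends to `𝔇(H)` (`exists_extension`).

In this action `V = z³ t`, so `S` is multiplication by
`s = (t - 1/3) / (t + 1/3) + (t + 1/3) / (t - 1/3)` (`map_S`). With `p = z⁻¹ y²`, which induces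
`σ : t ↦ t + 2` on `K`, one has `T = c⁻¹ S c` for `c = (1 + p) (1 - p)⁻¹`. A word in `S` and `T`,
followed by `S`, is applied to the vector `(1 + y) ∑ pⁿ`, which is fixed by `p` modulo Laurent
polynomials. The result is `s ^ a • y_l`, where `y_l` is an iterated sum: `l` is a list of letters
`(ε, a)`, and a letter acts as `c^ε s ^ (a + 1)` (`map_word_apply`). The word can be recovered from
`(a, l)` (`code_inj`).

Hence it suffices that the `y_l` are linearly independent over `K` modulo Laurent polynomials, and
that `s` is transcendental over `k`. The first is the analogue for difference equations of the
independence of hyperlogarithms over rational functions (`linearIndependent_words`): since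
`(1 - ε p) y_{(ε, a) l} = (1 + ε p) s ^ (a + 1) y_l`, a relation can be shortened by `1 - ε p`
unless a nontrivial combination of positive powers of `s` with `σ`-invariant coefficients has the
form `σ(f) - f` or `σ(f) + f`. That is impossible, because `s` has exactly one pole in the orbit
`1/3 + 2ℤ`, while `σ(f) ∓ f` has none or at least two (`eq_zero_of_map_eq`).

The symmetry of `S` and `T` is a direct computation: the involution fixes `V`, negates `z³`, and
sends `z + y²` to `-(z - y²)`.
-/

noncomputable section

/-! ### Independence of iterated sums -/

namespace IteratedSum

section Independence

variable {K M : Type*} [Field K] [AddCommGroup M] [Module K M]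

/-- The sign `±1` attached to a letter. -/
def sgn (K : Type*) [Field K] (b : Bool) : K := if b then 1 else -1

theorem sgn_mul_self (b : Bool) : sgn K b * sgn K b = 1 := by cases b <;> simp [sgn]

theorem map_sgn (σ : K →+* K) (b : Bool) : σ (sgn K b) = sgn K b := by cases b <;> simp [sgn]

/-- The sign of the first letter of a word; the empty word has sign `1`. -/
def headSgn (K : Type*) [Field K] : List (Bool × ℕ) → K
  | [] => 1
  | l :: _ => sgn K l.1

theorem exists_headSgn (w : List (Bool × ℕ)) : ∃ b, headSgn K w = sgn K b := by
  cases w with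
  | nil => exact ⟨true, rfl⟩
  | cons l w => exact ⟨l.1, rfl⟩

/-- The expression of `p (y w)` in terms of the `y v`, where `y` satisfies the recursion
`(1 - ε p) y ((ε, a) :: w) = (1 + ε p) (s ^ (a + 1) • y w)`. -/
def wordShift (σ : K →+* K) (s : K) : List (Bool × ℕ) → List (Bool × ℕ) →₀ K
  | [] => Finsupp.single [] 1
  | l :: w => Finsupp.single (l :: w) (sgn K l.1) - Finsupp.single w (sgn K l.1 * s ^ (l.2 + 1)) -
      σ (s ^ (l.2 + 1)) • wordShift σ s w

theorem wordShift_apply_of_length_lt (σ : K →+* K) (s : K) (w v : List (Bool × ℕ))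
    (h : w.length < v.length) : wordShift σ s w v = 0 := by
  induction w with
  | nil =>
    have : [] ≠ v := by rintro rfl; simp at h
    simp [wordShift, this]
  | cons l w ih =>
    simp only [List.length_cons] at h
    have h1 : l :: w ≠ v := by rintro rfl; simp at h
    have h2 : w ≠ v := by rintro rfl; omega
    simp [wordShift, h1, h2, ih (by omega)]

theorem wordShift_apply_of_length_eq (σ : K →+* K) (s : K) (w v : List (Bool × ℕ))
    (h : w.length = v.length) : wordShift σ s w v = if w = v then headSgn K v else 0 := by
  cases w with
  | nil =>
    have : v = [] := by simpa [eq_comm] using h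
    simp [this, wordShift, headSgn]
  | cons l w =>
    simp only [List.length_cons] at h
    have h2 : w ≠ v := by rintro rfl; omega
    by_cases h1 : l :: w = v
    · subst h1
      simp [wordShift, headSgn, wordShift_apply_of_length_lt]
    · simp [wordShift, h1, h2, wordShift_apply_of_length_lt σ s w v (by omega)]

theorem wordShift_cons_apply (σ : K →+* K) (s : K) (l : Bool × ℕ) (w v : List (Bool × ℕ))
    (h : w.length = v.length) : wordShift σ s (l :: w) v =
      if w = v then -(sgn K l.1 * s ^ (l.2 + 1) + σ (s ^ (l.2 + 1)) * headSgn K v) else 0 := by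
  have h1 : l :: w ≠ v := by rintro rfl; simp at h
  by_cases h2 : w = v
  · subst h2
    rw [wordShift, if_pos rfl]
    simp only [Finsupp.sub_apply, Finsupp.smul_apply, wordShift_apply_of_length_eq σ s w w rfl,
      if_true, Finsupp.single_eq_of_ne' h1, Finsupp.single_eq_same, smul_eq_mul]
    ring
  · simp [wordShift, h1, h2, wordShift_apply_of_length_eq σ s w v h]

/-- The semilinear operator on formal combinations of words that lifts `p`. -/
def shiftLift (σ : K →+* K) (s : K) (f : List (Bool × ℕ) →₀ K) : List (Bool × ℕ) →₀ K :=
  f.sum fun w r => σ r • wordShift σ s w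

theorem shiftLift_apply (σ : K →+* K) (s : K) (f : List (Bool × ℕ) →₀ K) (v : List (Bool × ℕ)) :
    shiftLift σ s f v = f.sum fun w r => σ r * wordShift σ s w v := by
  simp [shiftLift, Finsupp.sum, Finsupp.finsetSum_apply]

/-- On the longest words `p` acts diagonally, by the signs of their first letters. -/
theorem shiftLift_apply_top (σ : K →+* K) (s : K) (f : List (Bool × ℕ) →₀ K)
    (v : List (Bool × ℕ)) (hf : ∀ w, f w ≠ 0 → w.length ≤ v.length) :
    shiftLift σ s f v = σ (f v) * headSgn K v := by
  rw [shiftLift_apply, Finsupp.sum, Finset.sum_eq_single v]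
  · rw [wordShift_apply_of_length_eq σ s v v rfl, if_pos rfl]
  · intro w hw hwv
    rcases (hf w (Finsupp.mem_support_iff.1 hw)).lt_or_eq with h | h
    · rw [wordShift_apply_of_length_lt σ s w v h, mul_zero]
    · rw [wordShift_apply_of_length_eq σ s w v h, if_neg hwv, mul_zero]
  · intro h
    rw [Finsupp.notMem_support_iff.1 h, map_zero, zero_mul]

/-- The coefficients of the words `l :: v`, as a function of the letter `l`. -/
def consCoeff (f : List (Bool × ℕ) →₀ K) (v : List (Bool × ℕ)) : Bool × ℕ →₀ K :=
  f.comapDomain (fun l => l :: v) (fun _ _ _ _ h => (List.cons.inj h).1)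

theorem consCoeff_apply (f : List (Bool × ℕ) →₀ K) (v : List (Bool × ℕ)) (l : Bool × ℕ) :
    consCoeff f v l = f (l :: v) := rfl

/-- The coefficients of the words that are one letter shorter than the longest ones. -/
theorem shiftLift_apply_subtop (σ : K →+* K) (s : K) (f : List (Bool × ℕ) →₀ K)
    (v : List (Bool × ℕ)) (hf : ∀ w, f w ≠ 0 → w.length ≤ v.length + 1) :
    shiftLift σ s f v = σ (f v) * headSgn K v - (consCoeff f v).sum fun l r =>
      σ r * (sgn K l.1 * s ^ (l.2 + 1) + σ (s ^ (l.2 + 1)) * headSgn K v) := by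
  classical
  rw [shiftLift_apply, Finsupp.sum, Finsupp.sum]
  let T : Finset (List (Bool × ℕ)) := insert v ((consCoeff f v).support.image fun l => l :: v)
  have hv : v ∉ (consCoeff f v).support.image fun l => l :: v := by
    intro h
    obtain ⟨l, -, h⟩ := Finset.mem_image.1 h
    simpa using congrArg List.length h
  have hsub : ∑ w ∈ f.support, σ (f w) * wordShift σ s w v =
      ∑ w ∈ T, σ (f w) * wordShift σ s w v := by
    have h1 : ∑ w ∈ f.support, σ (f w) * wordShift σ s w v =
        ∑ w ∈ f.support ∪ T, σ (f w) * wordShift σ s w v := by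
      refine Finset.sum_subset Finset.subset_union_left fun w _ hw => ?_
      rw [Finsupp.notMem_support_iff.1 hw, map_zero, zero_mul]
    rw [h1]
    refine (Finset.sum_subset Finset.subset_union_right fun w hw hwT => ?_).symm
    rcases Finset.mem_union.1 hw with hw1 | hw1
    · have hwv : w ≠ v := fun h => hwT (h ▸ Finset.mem_insert_self _ _)
      rcases (hf w (Finsupp.mem_support_iff.1 hw1)).lt_or_eq with h | h
      · rcases (Nat.lt_succ_iff.1 h).lt_or_eq with h | h
        · rw [wordShift_apply_of_length_lt σ s w v h, mul_zero]
        · rw [wordShift_apply_of_length_eq σ s w v h, if_neg hwv, mul_zero]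
      · cases w with
        | nil => simp at h
        | cons l w =>
          rw [wordShift_cons_apply σ s l w v (by simpa using h), if_neg, mul_zero]
          rintro rfl
          refine hwT (Finset.mem_insert_of_mem (Finset.mem_image.2 ⟨l, ?_, rfl⟩))
          have hlw : f (l :: w) ≠ 0 := Finsupp.mem_support_iff.1 hw1
          exact Finsupp.mem_support_iff.2 hlw
    · exact absurd hw1 hwT
  rw [hsub, Finset.sum_insert hv, Finset.sum_image (fun _ _ _ _ h => (List.cons.inj h).1),
    wordShift_apply_of_length_eq σ s v v rfl, if_pos rfl, sub_eq_add_neg, ← Finset.sum_neg_distrib]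
  congr 1
  refine Finset.sum_congr rfl fun l _ => ?_
  rw [wordShift_cons_apply σ s l v v rfl, if_pos rfl, consCoeff_apply, mul_neg]

variable {σ : K →+* K} {s : K} {p : M →ₛₗ[σ] M} {y : List (Bool × ℕ) → M}

theorem linearCombination_wordShift (hnil : p (y []) = y [])
    (hcons : ∀ l w, y (l :: w) - sgn K l.1 • p (y (l :: w)) =
      s ^ (l.2 + 1) • y w + sgn K l.1 • p (s ^ (l.2 + 1) • y w)) (w : List (Bool × ℕ)) :
    Finsupp.linearCombination K y (wordShift σ s w) = p (y w) := by
  induction w with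
  | nil => simp [wordShift, hnil]
  | cons l w ih =>
    have h := congrArg (fun m => sgn K l.1 • m) (hcons l w)
    simp only [smul_sub, smul_add, smul_smul, sgn_mul_self, one_smul, map_smulₛₗ p] at h
    simp only [wordShift, map_sub, map_smul, ih, Finsupp.linearCombination_single]
    rw [← mul_assoc, sgn_mul_self, one_mul] at h
    rw [sub_sub, ← h]
    abel

theorem linearCombination_shiftLift (hnil : p (y []) = y [])
    (hcons : ∀ l w, y (l :: w) - sgn K l.1 • p (y (l :: w)) =
      s ^ (l.2 + 1) • y w + sgn K l.1 • p (s ^ (l.2 + 1) • y w)) (f : List (Bool × ℕ) →₀ K) :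
    Finsupp.linearCombination K y (shiftLift σ s f) =
      p (Finsupp.linearCombination K y f) := by
  rw [shiftLift, Finsupp.linearCombination_apply K f, Finsupp.sum, Finsupp.sum, map_sum, map_sum]
  refine Finset.sum_congr rfl fun w _ => ?_
  rw [map_smul, linearCombination_wordShift hnil hcons, map_smulₛₗ p]

/-- Iterated sums are linearly independent: if `(1 - ε p) y ((ε, a) :: w) =
(1 + ε p) (s ^ (a + 1) • y w)` and `p` fixes `y [] ≠ 0`, then the `y w` are independent over `K` as
soon as no nontrivial combination of positive powers of `s` with `σ`-invariant coefficients has the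
form `σ f - f` or `σ f + f`. Take a relation among words of length at most `m` with the fewest words
of length `m`, one of them having coefficient `1`. Applying `1 - ε p` removes that word, so it gives
the trivial relation; hence the coefficients of the words of length `m` are `σ`-invariant or zero,
and comparing the coefficients of a word of length `m - 1` gives a forbidden combination. -/
theorem linearIndependent_words (hnil : p (y []) = y []) (hne : y [] ≠ 0)
    (hcons : ∀ l w, y (l :: w) - sgn K l.1 • p (y (l :: w)) =
      s ^ (l.2 + 1) • y w + sgn K l.1 • p (s ^ (l.2 + 1) • y w))
    (h2 : (2 : K) ≠ 0) (hneg : ∀ f, σ f = -f → f = 0)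
    (hsum : ∀ (c : ℕ →₀ K) (b : Bool) (f : K), (∀ a, σ (c a) = c a) →
      σ f = sgn K b * f + c.sum (fun a r => r * s ^ (a + 1)) → c = 0) :
    LinearIndependent K y := by
  classical
  suffices main : ∀ (m : ℕ) (f : List (Bool × ℕ) →₀ K), (∀ w, f w ≠ 0 → w.length ≤ m) →
      Finsupp.linearCombination K y f = 0 → f = 0 by
    rw [linearIndependent_iff]
    intro f hf
    refine main (f.support.sup List.length) f (fun w hw => ?_) hf
    exact Finset.le_sup (f := List.length) (Finsupp.mem_support_iff.2 hw)
  intro m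
  induction m with
  | zero =>
    intro f hf h0
    have hf' : f = Finsupp.single [] (f []) := by
      ext w
      by_cases hw : w = []
      · simp [hw]
      · rw [Finsupp.single_eq_of_ne hw]
        by_contra h
        exact hw (List.length_eq_zero_iff.1 (Nat.le_zero.1 (hf w h)))
    rw [hf', Finsupp.linearCombination_single, smul_eq_zero] at h0
    rw [hf', h0.resolve_right hne, Finsupp.single_zero]
  | succ m ih =>
    intro f hf h0
    induction hN : (f.support.filter fun w => w.length = m + 1).card using Nat.strong_induction_on
      generalizing f with
    | _ N ihN =>
    by_cases hall : ∀ w, f w ≠ 0 → w.length ≤ m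
    · exact ih f hall h0
    push Not at hall
    obtain ⟨w₀, hw₀, hlen⟩ := hall
    have hlen₀ : w₀.length = m + 1 := le_antisymm (hf w₀ hw₀) hlen
    obtain ⟨⟨b₀, a₀⟩, v, rfl⟩ : ∃ l v, w₀ = l :: v := by
      cases w₀ with
      | nil => simp at hlen₀
      | cons l v => exact ⟨l, v, rfl⟩
    have hv : v.length = m := by simpa using hlen₀
    exfalso
    -- normalise the coefficient of the chosen word to `1`
    let g := (f ((b₀, a₀) :: v))⁻¹ • f
    have hg0 : g ((b₀, a₀) :: v) = 1 := by simp [g, hw₀]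
    have hgf : ∀ w, g w ≠ 0 → f w ≠ 0 := by
      intro w hw h
      exact hw (by simp [g, h])
    have hgl : ∀ w, g w ≠ 0 → w.length ≤ m + 1 := fun w hw => hf w (hgf w hw)
    let h := g - sgn K b₀ • shiftLift σ s g
    have hh0 : Finsupp.linearCombination K y h = 0 := by
      simp only [h, map_sub, map_smul, linearCombination_shiftLift hnil hcons, g, h0, smul_zero,
        map_zero, sub_zero]
    have htop : ∀ w, m + 1 ≤ w.length → h w = g w - sgn K b₀ * (σ (g w) * headSgn K w) := by
      intro w hw
      simp only [h, Finsupp.sub_apply, Finsupp.smul_apply, smul_eq_mul]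
      rw [shiftLift_apply_top σ s g w fun w' hw' => (hgl w' hw').trans hw]
    have hhl : ∀ w, h w ≠ 0 → w.length ≤ m + 1 := by
      intro w hw
      by_contra! hlt
      have hgw : g w = 0 := by
        by_contra h'
        exact absurd (hgl w h') (by omega)
      exact hw (by rw [htop w hlt.le, hgw, map_zero]; ring)
    have hz : h = 0 := by
      refine ihN _ ?_ h hhl hh0 rfl
      rw [← hN]
      refine Finset.card_lt_card ⟨fun w hw => ?_, fun hsub => ?_⟩
      · rw [Finset.mem_filter, Finsupp.mem_support_iff] at hw ⊢
        refine ⟨fun h' => hw.1 ?_, hw.2⟩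
        have hgw : g w = 0 := by simp [g, h']
        rw [htop w hw.2.ge, hgw, map_zero]
        ring
      · have hmem := hsub (Finset.mem_filter.2 ⟨Finsupp.mem_support_iff.2 hw₀, hlen₀⟩)
        rw [Finset.mem_filter, Finsupp.mem_support_iff, htop _ hlen₀.ge, hg0, map_one, headSgn,
          one_mul, sgn_mul_self, sub_self] at hmem
        exact hmem.1 rfl
    -- the coefficients of the words `l :: v` are invariant or vanish, by the sign of `l`
    have hinv : ∀ l : Bool × ℕ, g (l :: v) = sgn K b₀ * sgn K l.1 * σ (g (l :: v)) := by
      intro l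
      have h1 := htop (l :: v) (by simp [hv])
      rw [hz, Finsupp.zero_apply, eq_comm, sub_eq_zero, headSgn] at h1
      exact h1.trans (by ring)
    have hsame : ∀ a, σ (g ((b₀, a) :: v)) = g ((b₀, a) :: v) := by
      intro a
      have h1 := hinv (b₀, a)
      rw [sgn_mul_self, one_mul] at h1
      exact h1.symm
    have hother : ∀ b a, b ≠ b₀ → g ((b, a) :: v) = 0 := by
      intro b a hb
      refine hneg _ ?_
      have h1 := hinv (b, a)
      have h3 : sgn K b₀ * sgn K b = -1 := by
        cases b <;> cases b₀ <;> simp [sgn] at hb ⊢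
      rw [h3] at h1
      linear_combination h1
    let c : ℕ →₀ K := g.comapDomain (fun a => (b₀, a) :: v)
      (fun _ _ _ _ h => (Prod.ext_iff.1 (List.cons.inj h).1).2)
    have hc : ∀ a, c a = g ((b₀, a) :: v) := fun a => rfl
    have hsubtop := shiftLift_apply_subtop σ s g v fun w hw => by rw [hv]; exact hgl w hw
    have hsum' : ((consCoeff g v).sum fun l r =>
        σ r * (sgn K l.1 * s ^ (l.2 + 1) + σ (s ^ (l.2 + 1)) * headSgn K v)) =
        sgn K b₀ * c.sum (fun a r => r * s ^ (a + 1)) +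
          headSgn K v * σ (c.sum (fun a r => r * s ^ (a + 1))) := by
      have h1 : consCoeff g v = c.mapDomain (fun a => (b₀, a)) := by
        ext ⟨b, a⟩
        by_cases hb : b = b₀
        · subst hb
          rw [Finsupp.mapDomain_apply (fun _ _ h => (Prod.ext_iff.1 h).2)]
          rfl
        · rw [consCoeff_apply, hother b a hb, Finsupp.mapDomain_of_notMem_range]
          rintro ⟨a', h'⟩
          exact hb (Prod.ext_iff.1 h').1.symm
      rw [h1, Finsupp.sum_mapDomain_index (by simp) (by intros; simp; ring)]
      simp only [Finsupp.sum, map_sum, Finset.mul_sum, ← Finset.sum_add_distrib]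
      refine Finset.sum_congr rfl fun a _ => ?_
      rw [hc, map_mul, hsame]
      ring
    -- the coefficient of `v` in `h`, rewritten for `g v - q`, is of the excluded form
    have hzero : g v - sgn K b₀ * shiftLift σ s g v = 0 := by
      have h1 := DFunLike.congr_fun hz v
      simpa [h] using h1
    rw [hsubtop, hsum'] at hzero
    obtain ⟨b, hb⟩ := exists_headSgn (K := K) v
    rw [hb] at hzero
    set q := c.sum (fun a r => r * s ^ (a + 1)) with hq
    have hb₀ := sgn_mul_self (K := K) b₀
    have hbb := sgn_mul_self (K := K) b
    obtain ⟨d, hd⟩ : ∃ d, sgn K b₀ * sgn K b = sgn K d := by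
      cases b <;> cases b₀ <;> [exact ⟨true, by simp [sgn]⟩; exact ⟨false, by simp [sgn]⟩;
        exact ⟨false, by simp [sgn]⟩; exact ⟨true, by simp [sgn]⟩]
    have hdd := sgn_mul_self (K := K) d
    have hfin := hsum ((2 * sgn K d) • c) d (g v - q) (fun a => by
        rw [Finsupp.smul_apply, smul_eq_mul, map_mul, map_mul, map_sgn, hc, hsame,
          map_ofNat]) (by
      rw [Finsupp.sum_smul_index (by simp)]
      have h3 : (c.sum fun a r => 2 * sgn K d * r * s ^ (a + 1)) = 2 * sgn K d * q := by
        simp only [hq, Finsupp.sum, Finset.mul_sum, mul_assoc]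
      rw [h3, map_sub]
      have h4 : g v - sgn K d * σ (g v) + q + sgn K d * σ q = 0 := by
        rw [← hzero, ← hd]
        linear_combination (-q) * hb₀
      linear_combination (-sgn K d) * h4 - (σ (g v) - σ q) * hdd)
    have h5 := DFunLike.congr_fun hfin a₀
    rw [Finsupp.smul_apply, hc, hg0, smul_eq_mul, mul_one, Finsupp.zero_apply, mul_eq_zero] at h5
    rcases h5 with h5 | h5
    · exact h2 h5
    · rw [h5, mul_zero] at hdd
      exact zero_ne_one hdd

end Independence

end IteratedSum

/-! ### Poles along an orbit -/

namespace IteratedSum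

section Poles

variable {K : Type*} [Field K] {σ : K →+* K} {s : K} {O : ℤ → Subring K}

/-- An invariant element has no pole in the orbit, since it would have infinitely many. -/
theorem mem_of_invariant (hσ : ∀ f i, σ f ∈ O i ↔ f ∈ O (i + 1))
    (hfin : ∀ f, {i | f ∉ O i}.Finite) {c : K} (hc : σ c = c) (i : ℤ) : c ∈ O i := by
  have hstep : ∀ i, c ∈ O i ↔ c ∈ O (i + 1) := fun i => by rw [← hσ, hc]
  by_contra hi
  have hup : ∀ n : ℕ, c ∉ O (i + n) := by
    intro n
    induction n with
    | zero => simpa using hi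
    | succ n ih =>
      rw [Nat.cast_succ, ← add_assoc, ← hstep]
      exact ih
  refine Set.infinite_of_injective_forall_mem (f := fun n : ℕ => i + (n : ℤ)) ?_ hup (hfin c)
  intro m n h
  simpa using h

/-- A combination of positive powers of `s` whose coefficients are zero or units of `A`
lies in the subring `A` only if it is trivial, when `s⁻¹ ∈ A` but `s ∉ A`. -/
theorem eq_zero_of_sum_mem {A : Subring K} (hs : s ∉ A) (hs' : s⁻¹ ∈ A) {c : ℕ →₀ K}
    (hc : ∀ a, c a ∈ A) (hc' : ∀ a, (c a)⁻¹ ∈ A)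
    (hsum : c.sum (fun a r => r * s ^ (a + 1)) ∈ A) : c = 0 := by
  by_contra hne
  have hs0 : s ≠ 0 := fun h => hs (h ▸ A.zero_mem)
  have hsupp : c.support.Nonempty := Finsupp.support_nonempty_iff.2 hne
  let n := c.support.max' hsupp
  have hn : n ∈ c.support := c.support.max'_mem hsupp
  have hcn : c n ≠ 0 := Finsupp.mem_support_iff.1 hn
  -- after multiplication by `s⁻¹ ^ n` all terms but the leading one lie in `A`
  have h1 : s⁻¹ ^ n * c.sum (fun a r => r * s ^ (a + 1)) =
      c n * s + ∑ a ∈ c.support.erase n, c a * s⁻¹ ^ (n - (a + 1)) := by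
    rw [Finsupp.sum, ← Finset.add_sum_erase _ _ hn, mul_add, Finset.mul_sum]
    congr 1
    · rw [inv_pow, pow_succ]
      field_simp
    · refine Finset.sum_congr rfl fun a ha => ?_
      have hlt : a < n := lt_of_le_of_ne (c.support.le_max' a (Finset.mem_of_mem_erase ha))
        (Finset.ne_of_mem_erase ha)
      obtain ⟨d, hd⟩ := Nat.exists_eq_add_of_le (Nat.succ_le_of_lt hlt)
      rw [hd, Nat.succ_eq_add_one, Nat.add_sub_cancel_left, pow_add, inv_pow, inv_pow]
      field_simp
  have h2 : ∑ a ∈ c.support.erase n, c a * s⁻¹ ^ (n - (a + 1)) ∈ A :=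
    A.sum_mem fun a _ => A.mul_mem (hc a) (A.pow_mem hs' _)
  have h3 : c n * s ∈ A := by
    have h4 := A.sub_mem (A.mul_mem (A.pow_mem hs' n) hsum) h2
    rwa [h1, add_sub_cancel_right] at h4
  have h5 := A.mul_mem (hc' n) h3
  rw [inv_mul_cancel_left₀ hcn] at h5
  exact hs h5

/-- If `s` has a single pole in the orbit of points indexed by `ℤ`, then `σ f = ± f + q` is
impossible for a nontrivial combination `q` of positive powers of `s` with invariant coefficients:
the poles of `σ f ∓ f` in the orbit are either absent or at least two in number. -/
theorem eq_zero_of_map_eq (hσ : ∀ f i, σ f ∈ O i ↔ f ∈ O (i + 1))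
    (hfin : ∀ f, {i | f ∉ O i}.Finite) (hs : s ∉ O 0) (hs' : s⁻¹ ∈ O 0)
    (hsreg : ∀ i, i ≠ 0 → s ∈ O i) (c : ℕ →₀ K) (b : Bool) (f : K) (hc : ∀ a, σ (c a) = c a)
    (hf : σ f = sgn K b * f + c.sum (fun a r => r * s ^ (a + 1))) : c = 0 := by
  have hcO : ∀ a i, c a ∈ O i := fun a => mem_of_invariant hσ hfin (hc a)
  have hcO' : ∀ a i, (c a)⁻¹ ∈ O i := fun a =>
    mem_of_invariant hσ hfin (by rw [map_inv₀, hc])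
  set q := c.sum (fun a r => r * s ^ (a + 1)) with hq
  have hsgn : ∀ i, sgn K b ∈ O i := by
    intro i
    cases b
    · exact (O i).neg_mem (O i).one_mem
    · exact (O i).one_mem
  have hqreg : ∀ i, i ≠ 0 → q ∈ O i := fun i hi =>
    (O i).sum_mem fun a _ => (O i).mul_mem (hcO a i) ((O i).pow_mem (hsreg i hi) _)
  refine eq_zero_of_sum_mem hs hs' (fun a => hcO a 0) (fun a => hcO' a 0) ?_
  rw [← hq]
  by_contra hq0
  have hqf : ∀ i, σ f ∈ O i → f ∈ O i → i ≠ 0 := by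
    rintro i h1 h2 rfl
    refine hq0 ?_
    rw [show q = σ f - sgn K b * f by rw [hf]; ring]
    exact (O 0).sub_mem h1 ((O 0).mul_mem (hsgn 0) h2)
  have hiff : ∀ i, i ≠ 0 → (f ∈ O i ↔ f ∈ O (i + 1)) := by
    intro i hi
    rw [← hσ]
    constructor
    · intro h
      rw [hf]
      exact (O i).add_mem ((O i).mul_mem (hsgn i) h) (hqreg i hi)
    · intro h
      have h1 : f = sgn K b * (σ f - q) := by
        rw [hf, add_sub_cancel_right, ← mul_assoc, sgn_mul_self, one_mul]
      rw [h1]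
      exact (O i).mul_mem (hsgn i) ((O i).sub_mem h (hqreg i hi))
  -- the poles of `f` are constant along `i ≤ 0` and along `i ≥ 1`, so there are none
  have hpos : f ∈ O 1 := by
    by_contra h
    have hup : ∀ n : ℕ, f ∉ O (1 + n) := by
      intro n
      induction n with
      | zero => simpa using h
      | succ n ih =>
        rw [Nat.cast_succ, ← add_assoc, ← hiff _ (by omega)]
        exact ih
    refine Set.infinite_of_injective_forall_mem (f := fun n : ℕ => 1 + (n : ℤ)) ?_ hup (hfin f)
    intro m n h
    simpa using h
  have hneg : f ∈ O 0 := by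
    by_contra h
    have hdown : ∀ n : ℕ, f ∉ O (-n) := by
      intro n
      induction n with
      | zero => simpa using h
      | succ n ih =>
        rw [hiff _ (by omega), Nat.cast_succ, neg_add, neg_add_cancel_right]
        exact ih
    refine Set.infinite_of_injective_forall_mem (f := fun n : ℕ => -(n : ℤ)) ?_ hdown (hfin f)
    intro m n h
    simpa using h
  exact hqf 0 ((hσ f 0).2 (by simpa using hpos)) hneg rfl

/-- The powers of `s` are independent over a field contained in `A`, when `s⁻¹ ∈ A` but `s ∉ A`. -/
theorem linearIndependent_pow_of_notMem {k : Type*} [Field k] [Algebra k K] {A : Subring K}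
    (hk : ∀ r : k, algebraMap k K r ∈ A) (hs : s ∉ A) (hs' : s⁻¹ ∈ A) :
    LinearIndependent k (fun n : ℕ => s ^ n) := by
  rw [linearIndependent_iff]
  intro l hl
  have hs0 : s ≠ 0 := fun h => hs (h ▸ A.zero_mem)
  let c : ℕ →₀ K := l.mapRange (algebraMap k K) (map_zero _)
  have hc : c = 0 := by
    refine eq_zero_of_sum_mem hs hs' (fun a => hk _) (fun a => ?_) ?_
    · rw [Finsupp.mapRange_apply, ← map_inv₀]
      exact hk _
    · rw [Finsupp.sum_mapRange_index (by simp)]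
      have h := congrArg (fun f => f * s) hl
      simp only [Finsupp.linearCombination_apply, Finsupp.sum, Finset.sum_mul, zero_mul,
        Algebra.smul_def, mul_assoc, ← pow_succ] at h
      rw [Finsupp.sum, h]
      exact A.zero_mem
  ext a
  have h := DFunLike.congr_fun hc a
  rw [Finsupp.mapRange_apply, Finsupp.zero_apply, map_eq_zero] at h
  exact h

end Poles

end IteratedSum

/-! ### The field of rational functions and its shift -/

namespace ShiftField

section

variable (F : Type*) [Field F]

/-- The automorphism `f(t) ↦ f(t + 1)` of the field of rational functions `F(t)`. -/
def shift : RatFunc F ≃ₐ[F] RatFunc F :=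
  IsFractionRing.algEquivOfAlgEquiv (taylorEquiv (1 : F))

theorem shift_algebraMap (P : F[X]) :
    shift F (algebraMap F[X] (RatFunc F) P) = algebraMap F[X] (RatFunc F) (taylor 1 P) :=
  IsFractionRing.algEquivOfAlgEquiv_algebraMap _ _

theorem shift_X : shift F (RatFunc.X : RatFunc F) = RatFunc.X + 1 := by
  rw [← RatFunc.algebraMap_X, shift_algebraMap, taylor_X, map_add, C_1, map_one]

variable {F}

/-- The rational functions that are regular at the point `a`. -/
def regularAt (a : F) : Subring (RatFunc F) where
  carrier := {f | ∃ P Q : F[X], Q.eval a ≠ 0 ∧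
    f * algebraMap F[X] (RatFunc F) Q = algebraMap F[X] (RatFunc F) P}
  mul_mem' := by
    rintro f g ⟨P, Q, hQ, h⟩ ⟨P', Q', hQ', h'⟩
    refine ⟨P * P', Q * Q', by rw [eval_mul]; exact mul_ne_zero hQ hQ', ?_⟩
    rw [map_mul, map_mul, ← h, ← h']
    ring
  one_mem' := ⟨1, 1, by simp, by simp⟩
  add_mem' := by
    rintro f g ⟨P, Q, hQ, h⟩ ⟨P', Q', hQ', h'⟩
    refine ⟨P * Q' + P' * Q, Q * Q', by rw [eval_mul]; exact mul_ne_zero hQ hQ', ?_⟩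
    rw [map_add, map_mul, map_mul, map_mul, ← h, ← h']
    ring
  zero_mem' := ⟨0, 1, by simp, by simp⟩
  neg_mem' := by
    rintro f ⟨P, Q, hQ, h⟩
    exact ⟨-P, Q, hQ, by rw [neg_mul, h, map_neg]⟩

theorem algebraMap_mem_regularAt (a c : F) : algebraMap F (RatFunc F) c ∈ regularAt a := by
  refine ⟨C c, 1, by simp, ?_⟩
  rw [map_one, mul_one, RatFunc.algebraMap_C]
  rfl

theorem shift_mem_regularAt {a : F} {f : RatFunc F} :
    shift F f ∈ regularAt a ↔ f ∈ regularAt (a + 1) := by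
  constructor
  · rintro ⟨P, Q, hQ, h⟩
    refine ⟨taylor (-1) P, taylor (-1) Q, by rw [taylor_eval, add_neg_cancel_right]; exact hQ, ?_⟩
    refine (shift F).injective ?_
    rw [map_mul, shift_algebraMap, shift_algebraMap, taylor_taylor, taylor_taylor]
    simpa using h
  · rintro ⟨P, Q, hQ, h⟩
    refine ⟨taylor 1 P, taylor 1 Q, by rw [taylor_eval]; exact hQ, ?_⟩
    rw [← shift_algebraMap, ← shift_algebraMap, ← map_mul, h]

theorem mul_denom_eq_num (f : RatFunc F) :
    f * algebraMap F[X] (RatFunc F) f.denom = algebraMap F[X] (RatFunc F) f.num :=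
  (eq_div_iff (RatFunc.algebraMap_ne_zero f.denom_ne_zero)).1 (RatFunc.num_div_denom f).symm

theorem finite_notMem_regularAt (f : RatFunc F) : {a | f ∉ regularAt a}.Finite := by
  refine (f.denom.rootSet_finite F).subset fun a ha => ?_
  rw [mem_rootSet_of_ne f.denom_ne_zero]
  by_contra h
  refine ha ⟨f.num, f.denom, by simpa using h, ?_⟩
  exact mul_denom_eq_num f

/-- Comparison of leading coefficients excludes `f(t + 2) = -f(t)`. -/
theorem eq_zero_of_shift_shift_eq_neg [CharZero F] {f : RatFunc F}
    (hf : shift F (shift F f) = -f) : f = 0 := by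
  have hfD := mul_denom_eq_num f
  have h1 := congrArg (fun g => shift F (shift F g)) hfD
  simp only [map_mul, shift_algebraMap, hf] at h1
  have h2 : -(f.num * taylor 1 (taylor 1 f.denom)) = taylor 1 (taylor 1 f.num) * f.denom := by
    refine RatFunc.algebraMap_injective F ?_
    rw [map_neg, map_mul, map_mul, ← h1, ← hfD]
    ring
  have h3 := congrArg leadingCoeff h2
  simp only [leadingCoeff_neg, leadingCoeff_mul, leadingCoeff_taylor] at h3
  have h4 : f.num.leadingCoeff * f.denom.leadingCoeff = 0 := by
    have h5 : (2 : F) * (f.num.leadingCoeff * f.denom.leadingCoeff) = 0 := by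
      linear_combination -h3
    exact (mul_eq_zero.1 h5).resolve_left two_ne_zero
  rcases mul_eq_zero.1 h4 with h | h
  · exact RatFunc.num_eq_zero_iff.1 (leadingCoeff_eq_zero.1 h)
  · exact absurd (leadingCoeff_eq_zero.1 h) f.denom_ne_zero

variable (F) in
/-- The rational function by which `S` acts, with simple poles at `±1/3`. -/
def sFun : RatFunc F :=
  (RatFunc.X - algebraMap F (RatFunc F) (1 / 3)) *
      (RatFunc.X + algebraMap F (RatFunc F) (1 / 3))⁻¹ +
    (RatFunc.X - algebraMap F (RatFunc F) (1 / 3))⁻¹ *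
      (RatFunc.X + algebraMap F (RatFunc F) (1 / 3))

theorem X_sub_C_ne_zero (c : F) : RatFunc.X - algebraMap F (RatFunc F) c ≠ 0 := by
  have h : RatFunc.X - algebraMap F (RatFunc F) c = algebraMap F[X] (RatFunc F) (X - C c) := by
    rw [map_sub, RatFunc.algebraMap_X, RatFunc.algebraMap_C]
    rfl
  rw [h]
  exact RatFunc.algebraMap_ne_zero (Polynomial.X_sub_C_ne_zero c)

theorem X_add_C_ne_zero (c : F) : RatFunc.X + algebraMap F (RatFunc F) c ≠ 0 := by
  have h := X_sub_C_ne_zero (-c)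
  rwa [map_neg, sub_neg_eq_add] at h

theorem sFun_mul (F : Type*) [Field F] [CharZero F] :
    sFun F * algebraMap F[X] (RatFunc F) (X ^ 2 - C (1 / 9)) =
      algebraMap F[X] (RatFunc F) (2 * X ^ 2 + C (2 / 9)) := by
  have h1 := X_sub_C_ne_zero (1 / 3 : F)
  have h2 := X_add_C_ne_zero (1 / 3 : F)
  have hC : ∀ c : F, algebraMap F[X] (RatFunc F) (C c) = algebraMap F (RatFunc F) c := fun c => by
    rw [RatFunc.algebraMap_C]
    rfl
  have h9 : algebraMap F (RatFunc F) (1 / 9) = algebraMap F (RatFunc F) (1 / 3) ^ 2 := by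
    rw [← map_pow]; norm_num
  have h29 : algebraMap F (RatFunc F) (2 / 9) = 2 * algebraMap F (RatFunc F) (1 / 3) ^ 2 := by
    rw [← map_pow, ← map_ofNat (algebraMap F (RatFunc F)), ← map_mul]; norm_num
  rw [map_sub, map_add, map_mul, map_pow, map_ofNat, RatFunc.algebraMap_X, hC, hC, h9, h29, sFun]
  field_simp
  ring

variable (F) in
/-- The rational functions that are regular at the `i`-th point of the orbit `1/3 + 2ℤ`. -/
def regularInOrbit (i : ℤ) : Subring (RatFunc F) := regularAt (1 / 3 + 2 * (i : F))

theorem regularInOrbit_zero : regularInOrbit F 0 = regularAt (1 / 3 : F) := by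
  simp [regularInOrbit]

variable [CharZero F]

theorem sFun_mem_regularAt {a : F} (ha : a ^ 2 - 1 / 9 ≠ 0) : sFun F ∈ regularAt a :=
  ⟨_, _, by simpa using ha, sFun_mul F⟩

theorem sFun_notMem_regularAt : sFun F ∉ regularAt (1 / 3 : F) := by
  rintro ⟨P, Q, hQ, h⟩
  have h1 : (2 * X ^ 2 + C (2 / 9)) * Q = P * (X ^ 2 - C (1 / 9)) := by
    refine RatFunc.algebraMap_injective F ?_
    rw [map_mul, map_mul, ← sFun_mul, ← h]
    ring
  have h2 := congrArg (eval (1 / 3 : F)) h1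
  simp only [eval_mul, eval_add, eval_sub, eval_pow, eval_X, eval_C, eval_ofNat] at h2
  norm_num at h2
  exact hQ (by simpa using h2)

theorem inv_sFun_mem_regularAt : (sFun F)⁻¹ ∈ regularAt (1 / 3 : F) := by
  refine ⟨X ^ 2 - C (1 / 9), 2 * X ^ 2 + C (2 / 9), ?_, ?_⟩
  · simp only [eval_mul, eval_add, eval_pow, eval_X, eval_C, eval_ofNat]
    norm_num
  · have h0 : sFun F ≠ 0 := fun h =>
      sFun_notMem_regularAt (F := F) (h ▸ (regularAt (1 / 3 : F)).zero_mem)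
    rw [← sFun_mul, inv_mul_cancel_left₀ h0]

theorem shift_shift_mem_regularInOrbit (f : RatFunc F) (i : ℤ) :
    shift F (shift F f) ∈ regularInOrbit F i ↔ f ∈ regularInOrbit F (i + 1) := by
  rw [regularInOrbit, regularInOrbit, shift_mem_regularAt, shift_mem_regularAt]
  have h : (1 / 3 + 2 * (i : F) + 1 + 1) = 1 / 3 + 2 * ((i + 1 : ℤ) : F) := by push_cast; ring
  rw [h]

theorem finite_notMem_regularInOrbit (f : RatFunc F) :
    {i | f ∉ regularInOrbit F i}.Finite := by
  refine (finite_notMem_regularAt f).preimage (f := fun i : ℤ => 1 / 3 + 2 * (i : F)) ?_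
  intro i _ j _ h
  simpa using h

theorem sFun_mem_regularInOrbit (i : ℤ) (hi : i ≠ 0) : sFun F ∈ regularInOrbit F i := by
  refine sFun_mem_regularAt ?_
  have h1 : (i : F) ≠ 0 := Int.cast_ne_zero.2 hi
  have h2 : ((3 * i + 1 : ℤ) : F) ≠ 0 := Int.cast_ne_zero.2 (by omega)
  have h3 : (1 / 3 + 2 * (i : F)) ^ 2 - 1 / 9 = 4 / 3 * i * (3 * i + 1 : ℤ) := by
    push_cast
    ring
  rw [h3]
  exact mul_ne_zero (mul_ne_zero (by norm_num) h1) h2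

theorem linearIndependent_X_pow (F : Type*) [Field F] :
    LinearIndependent F (fun n : ℕ => (RatFunc.X : RatFunc F) ^ n) := by
  have h := (Polynomial.basisMonomials F).linearIndependent.map'
    ((Algebra.linearMap F[X] (RatFunc F)).restrictScalars F)
    (LinearMap.ker_eq_bot.2 (RatFunc.algebraMap_injective F))
  have h' : (fun n : ℕ => (RatFunc.X : RatFunc F) ^ n) =
      ((Algebra.linearMap F[X] (RatFunc F)).restrictScalars F) ∘ Polynomial.basisMonomials F := by
    funext n
    rw [Polynomial.coe_basisMonomials]
    change _ = algebraMap F[X] (RatFunc F) (monomial n 1)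
    rw [← Polynomial.X_pow_eq_monomial, map_pow,
      RatFunc.algebraMap_X]
  rw [h']
  exact h

theorem linearIndependent_descPochhammer :
    LinearIndependent F (fun n : ℕ => (descPochhammer (RatFunc F) n).eval
      (RatFunc.X - algebraMap F (RatFunc F) (1 / 2))) := by
  let Q : Polynomial.Sequence F :=
    { elems' := fun n => taylor (-(1 / 2)) (descPochhammer F n)
      degree_eq' := fun n => by
        rw [degree_taylor, degree_eq_natDegree (monic_descPochhammer F n).ne_zero,
          descPochhammer_natDegree] }
  have h := Q.linearIndependent.map' ((Algebra.linearMap F[X] (RatFunc F)).restrictScalars F)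
    (LinearMap.ker_eq_bot.2 (RatFunc.algebraMap_injective F))
  have h' : (fun n : ℕ => (descPochhammer (RatFunc F) n).eval
      (RatFunc.X - algebraMap F (RatFunc F) (1 / 2))) =
      ((Algebra.linearMap F[X] (RatFunc F)).restrictScalars F) ∘ Q := by
    funext n
    change _ = algebraMap F[X] (RatFunc F) (taylor (-(1 / 2)) (descPochhammer F n))
    rw [taylor_apply, comp, hom_eval₂, ← descPochhammer_map (algebraMap F (RatFunc F)), eval_map]
    congr 1
    rw [map_add, RatFunc.algebraMap_X, RatFunc.algebraMap_C, map_neg, ← sub_eq_add_neg]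
    rfl
  rw [h']
  exact h

end

end ShiftField

/-! ### Operators on Laurent series -/

/-- Laurent series over `K`, as the functions `ℤ → K` that vanish below some bound. -/
def LaurentFun (K : Type*) [Field K] : Submodule K (ℤ → K) where
  carrier := {m | ∃ N, ∀ n < N, m n = 0}
  add_mem' := by
    rintro m m' ⟨N, h⟩ ⟨N', h'⟩
    refine ⟨min N N', fun n hn => ?_⟩
    rw [Pi.add_apply, h n (by omega), h' n (by omega), add_zero]
  zero_mem' := ⟨0, fun _ _ => rfl⟩
  smul_mem' := by
    rintro c m ⟨N, h⟩
    exact ⟨N, fun n hn => by rw [Pi.smul_apply, h n hn, smul_zero]⟩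

namespace LaurentFun

section

variable {k K : Type*} [Field k] [Field K] [Algebra k K]

@[ext]
theorem ext {m m' : LaurentFun K} (h : ∀ n, m.1 n = m'.1 n) : m = m' := Subtype.ext (funext h)

theorem add_val (m m' : LaurentFun K) (n : ℤ) : (m + m').1 n = m.1 n + m'.1 n := rfl

theorem sub_val (m m' : LaurentFun K) (n : ℤ) : (m - m').1 n = m.1 n - m'.1 n := rfl

theorem smul_val (c : K) (m : LaurentFun K) (n : ℤ) : (c • m).1 n = c * m.1 n := rfl

theorem zero_val (n : ℤ) : (0 : LaurentFun K).1 n = 0 := rfl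

theorem sum_val {ι : Type*} (s : Finset ι) (f : ι → LaurentFun K) (n : ℤ) :
    (∑ i ∈ s, f i).1 n = ∑ i ∈ s, (f i).1 n := by
  rw [AddSubmonoidClass.coe_finsetSum, Finset.sum_apply]

/-- The Laurent series with the single coefficient `r` at `n`. -/
def single (n : ℤ) (r : K) : LaurentFun K :=
  ⟨Pi.single n r, n, fun j hj => by rw [Pi.single_eq_of_ne hj.ne]⟩

theorem single_val (n j : ℤ) (r : K) : (single n r).1 j = if j = n then r else 0 :=
  Pi.single_apply n r j

/-- The operator `f y ^ d` on Laurent series in `y` with coefficients in `K`, where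
`y r = τ r y` for `r` in `K`. -/
def shiftOp (τ : K ≃ₐ[k] K) (f : K) (d : ℤ) : Module.End k (LaurentFun K) where
  toFun m := ⟨fun n => f * (τ ^ d) (m.1 (n - d)), by
    obtain ⟨N, h⟩ := m.2
    exact ⟨N + d, fun n hn => by
      have h0 : m.1 (n - d) = 0 := h _ (by omega)
      simp only [h0, map_zero, mul_zero]⟩⟩
  map_add' m m' := by
    ext n
    change f * (τ ^ d) (m.1 (n - d) + m'.1 (n - d)) = _
    rw [map_add, mul_add]
    rfl
  map_smul' c m := by
    ext n
    change f * (τ ^ d) (c • m.1 (n - d)) = c • (f * (τ ^ d) (m.1 (n - d)))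
    rw [map_smul, mul_smul_comm]

variable (τ : K ≃ₐ[k] K)

theorem shiftOp_val (f : K) (d : ℤ) (m : LaurentFun K) (n : ℤ) :
    (shiftOp τ f d m).1 n = f * (τ ^ d) (m.1 (n - d)) := rfl

theorem shiftOp_zero_apply (f : K) (m : LaurentFun K) : shiftOp τ f 0 m = f • m := by
  ext n
  rw [shiftOp_val, smul_val, sub_zero, zpow_zero]
  rfl

theorem shiftOp_mul (f g : K) (d e : ℤ) :
    shiftOp τ f d * shiftOp τ g e = shiftOp τ (f * (τ ^ d) g) (d + e) := by
  refine LinearMap.ext fun m => ext fun n => ?_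
  rw [Module.End.mul_apply, shiftOp_val, shiftOp_val, shiftOp_val, map_mul, zpow_add, ← mul_assoc,
    sub_sub]
  rfl

theorem shiftOp_add (f g : K) (d : ℤ) : shiftOp τ f d + shiftOp τ g d = shiftOp τ (f + g) d := by
  refine LinearMap.ext fun m => ext fun n => ?_
  rw [LinearMap.add_apply, add_val, shiftOp_val, shiftOp_val, shiftOp_val, add_mul]

theorem shiftOp_sub (f g : K) (d : ℤ) : shiftOp τ f d - shiftOp τ g d = shiftOp τ (f - g) d := by
  refine LinearMap.ext fun m => ext fun n => ?_
  rw [LinearMap.sub_apply, sub_val, shiftOp_val, shiftOp_val, shiftOp_val, sub_mul]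

theorem smul_shiftOp (c : k) (f : K) (d : ℤ) : c • shiftOp τ f d = shiftOp τ (c • f) d := by
  refine LinearMap.ext fun m => ext fun n => ?_
  change c • (f * (τ ^ d) (m.1 (n - d))) = (c • f) * (τ ^ d) (m.1 (n - d))
  rw [smul_mul_assoc]

theorem shiftOp_one : shiftOp τ 1 0 = 1 := by
  refine LinearMap.ext fun m => ?_
  rw [shiftOp_zero_apply, one_smul]
  rfl

theorem shiftOp_pow_zero (f : K) (n : ℕ) : shiftOp τ f 0 ^ n = shiftOp τ (f ^ n) 0 := by
  induction n with
  | zero => rw [pow_zero, pow_zero, shiftOp_one]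
  | succ n ih =>
    rw [pow_succ, ih, shiftOp_mul, zpow_zero, pow_succ, add_zero]
    rfl

theorem shiftOp_one_pow (d : ℤ) (n : ℕ) : shiftOp τ 1 d ^ n = shiftOp τ 1 (d * n) := by
  induction n with
  | zero => rw [pow_zero, Nat.cast_zero, mul_zero, shiftOp_one]
  | succ n ih =>
    rw [pow_succ, ih, shiftOp_mul, map_one, mul_one, Nat.cast_succ, mul_add, mul_one]

/-- The operator `φ` has leading term `f y ^ a`. -/
def HasLeadingTerm (φ : Module.End k (LaurentFun K)) (f : K) (a : ℤ) : Prop :=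
  ∀ (m : LaurentFun K) (n : ℤ), (∀ j < n, m.1 j = 0) →
    (∀ j < n + a, (φ m).1 j = 0) ∧ (φ m).1 (n + a) = f * (τ ^ a) (m.1 n)

variable {τ}

theorem exists_order {m : LaurentFun K} (hm : m ≠ 0) :
    ∃ n, m.1 n ≠ 0 ∧ ∀ j < n, m.1 j = 0 := by
  obtain ⟨N, hN⟩ := m.2
  have h1 : ∃ n, m.1 n ≠ 0 := by
    by_contra! h
    exact hm (ext h)
  obtain ⟨n, hn, hmin⟩ := Int.exists_least_of_bdd (P := fun n => m.1 n ≠ 0)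
    ⟨N, fun j hj => by
      by_contra! hlt
      exact hj (hN j hlt)⟩ h1
  refine ⟨n, hn, fun j hj => ?_⟩
  by_contra h
  exact absurd (hmin j h) (by omega)

/-- The successive approximations to a preimage of `b` under an operator with leading term
`f y ^ a`, for `b` of order at least `n₀ + a`. -/
def approx (τ : K ≃ₐ[k] K) (φ : Module.End k (LaurentFun K)) (f : K) (a n₀ : ℤ)
    (b : LaurentFun K) : ℕ → LaurentFun K
  | 0 => 0
  | j + 1 => approx τ φ f a n₀ b j +
      single (n₀ + j) ((τ ^ a).symm (f⁻¹ * (b - φ (approx τ φ f a n₀ b j)).1 (n₀ + j + a)))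

theorem approx_succ_val (φ : Module.End k (LaurentFun K)) (f : K) (a n₀ : ℤ) (b : LaurentFun K)
    (j : ℕ) (n : ℤ) (hn : n ≠ n₀ + j) :
    (approx τ φ f a n₀ b (j + 1)).1 n = (approx τ φ f a n₀ b j).1 n := by
  rw [approx, add_val, single_val, if_neg hn, add_zero]

theorem approx_val_of_le (φ : Module.End k (LaurentFun K)) (f : K) (a n₀ : ℤ) (b : LaurentFun K)
    (j : ℕ) (n : ℤ) (hn : n < n₀ + j) (i : ℕ) :
    (approx τ φ f a n₀ b (j + i)).1 n = (approx τ φ f a n₀ b j).1 n := by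
  induction i with
  | zero => rfl
  | succ i ih =>
    rw [← add_assoc, approx_succ_val _ _ _ _ _ _ _ (by push_cast; omega), ih]

theorem approx_val_of_lt (φ : Module.End k (LaurentFun K)) (f : K) (a n₀ : ℤ) (b : LaurentFun K)
    (n : ℤ) (hn : n < n₀) (j : ℕ) : (approx τ φ f a n₀ b j).1 n = 0 := by
  have h := approx_val_of_le (τ := τ) φ f a n₀ b 0 n (by simpa using hn) j
  rwa [zero_add] at h

theorem sub_approx_val {φ : Module.End k (LaurentFun K)} {f : K} {a : ℤ} (hf : f ≠ 0)
    (hφ : HasLeadingTerm τ φ f a) (n₀ : ℤ) (b : LaurentFun K) (hb : ∀ i < n₀ + a, b.1 i = 0)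
    (j : ℕ) : ∀ i < n₀ + j + a, (b - φ (approx τ φ f a n₀ b j)).1 i = 0 := by
  induction j with
  | zero =>
    intro i hi
    rw [approx, map_zero, sub_zero]
    exact hb i (by simpa using hi)
  | succ j ih =>
    intro i hi
    obtain ⟨h1, h2⟩ := hφ (single (n₀ + j)
      ((τ ^ a).symm (f⁻¹ * (b - φ (approx τ φ f a n₀ b j)).1 (n₀ + j + a)))) (n₀ + j)
      (fun i hi => by rw [single_val, if_neg (by omega)])
    rw [approx, map_add, ← sub_sub, sub_val]
    rcases lt_or_eq_of_le (show i ≤ n₀ + j + a by push_cast at hi; omega) with hlt | rfl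
    · rw [ih i hlt, h1 i hlt, sub_zero]
    · rw [h2, single_val, if_pos rfl, AlgEquiv.apply_symm_apply, mul_inv_cancel_left₀ hf, sub_self]

/-- An operator with a nonzero leading term is bijective, because Laurent series are complete. -/
theorem HasLeadingTerm.isUnit {φ : Module.End k (LaurentFun K)} {f : K} {a : ℤ} (hf : f ≠ 0)
    (hφ : HasLeadingTerm τ φ f a) : IsUnit φ := by
  rw [Module.End.isUnit_iff]
  constructor
  · refine (injective_iff_map_eq_zero φ).2 fun m hm => ?_
    by_contra hne
    obtain ⟨n, hn, hlt⟩ := exists_order hne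
    have h := (hφ m n hlt).2
    rw [hm, zero_val, eq_comm, mul_eq_zero] at h
    exact hn ((map_eq_zero_iff _ (τ ^ a).injective).1 (h.resolve_left hf))
  · intro b
    obtain ⟨N, hN⟩ := b.2
    obtain ⟨n₀, rfl⟩ : ∃ n₀, N = n₀ + a := ⟨N - a, by omega⟩
    let m : LaurentFun K := ⟨fun n => (approx τ φ f a n₀ b ((n - n₀).toNat + 1)).1 n,
      n₀, fun n hn => approx_val_of_lt φ f a n₀ b n hn _⟩
    have hm : ∀ (j : ℕ) (n : ℤ), n < n₀ + j → m.1 n = (approx τ φ f a n₀ b j).1 n := by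
      intro j n hn
      by_cases hn₀ : n < n₀
      · exact (approx_val_of_lt (τ := τ) φ f a n₀ b n hn₀ ((n - n₀).toNat + 1)).trans
          (approx_val_of_lt (τ := τ) φ f a n₀ b n hn₀ j).symm
      · obtain ⟨i, hi⟩ := Nat.exists_eq_add_of_le (show (n - n₀).toNat + 1 ≤ j by omega)
        rw [hi]
        exact (approx_val_of_le (τ := τ) φ f a n₀ b ((n - n₀).toNat + 1) n
          (by push_cast; omega) i).symm
    refine ⟨m, ext fun i => ?_⟩
    let j : ℕ := (i - n₀ - a).toNat + 1
    have hj : i < n₀ + j + a := by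
      simp only [j]
      push_cast
      omega
    have h1 := (hφ (m - approx τ φ f a n₀ b j) (n₀ + j)
      (fun n hn => by rw [sub_val, hm j n hn, sub_self])).1 i hj
    have h2 := sub_approx_val hf hφ n₀ b hN j i hj
    rw [map_sub, sub_val] at h1
    rw [sub_val] at h2
    rw [sub_eq_zero.1 h1, ← sub_eq_zero.1 h2]

/-- A nonzero skew Laurent polynomial acts bijectively on Laurent series. -/
theorem isUnit_sum_shiftOp (s : Finset ℤ) (f : ℤ → K) (hf : ∃ d ∈ s, f d ≠ 0) :
    IsUnit (∑ d ∈ s, shiftOp τ (f d) d) := by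
  classical
  let s' := s.filter fun d => f d ≠ 0
  have hs' : s'.Nonempty := by
    obtain ⟨d, hd, hfd⟩ := hf
    exact ⟨d, Finset.mem_filter.2 ⟨hd, hfd⟩⟩
  have hmem := s'.min'_mem hs'
  let a := s'.min' hs'
  refine HasLeadingTerm.isUnit (τ := τ) (f := f a) (a := a) (Finset.mem_filter.1 hmem).2 ?_
  have hsmall : ∀ d ∈ s, d < a → f d = 0 := by
    intro d hd hlt
    by_contra h
    exact absurd (s'.min'_le d (Finset.mem_filter.2 ⟨hd, h⟩)) (not_le.2 hlt)
  intro m n hm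
  refine ⟨fun j hj => ?_, ?_⟩
  · rw [LinearMap.sum_apply, sum_val]
    refine Finset.sum_eq_zero fun d hd => ?_
    rw [shiftOp_val]
    rcases lt_or_ge d a with hlt | hge
    · rw [hsmall d hd hlt, zero_mul]
    · rw [hm _ (by omega), map_zero, mul_zero]
  · rw [LinearMap.sum_apply, sum_val, Finset.sum_eq_single_of_mem a (Finset.mem_filter.1 hmem).1]
    · rw [shiftOp_val, add_sub_cancel_right]
    · intro d hd hne
      rw [shiftOp_val]
      rcases lt_or_gt_of_ne hne with hlt | hgt
      · rw [hsmall d hd hlt, zero_mul]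
      · rw [hm _ (by omega), map_zero, mul_zero]

end

end LaurentFun

/-! ### The action of the enveloping algebra and of its division ring of fractions -/

namespace HeisenbergD

open LaurentFun

section Representation

attribute [local instance] LieRing.ofAssociativeRing

variable {k : Type*} {K : Type*} [Field k] [Field K] [Algebra k K] {τ : K ≃ₐ[k] K} {z t : K}

theorem yOp_mul_xOp (hz : τ z = z) (ht : τ t = t + 1) :
    shiftOp τ 1 1 * shiftOp τ (z * (t - 1 / 2)) (-1) =
      shiftOp τ (z * (t - 1 / 2)) (-1) * shiftOp τ 1 1 + shiftOp τ z 0 := by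
  rw [shiftOp_mul, shiftOp_mul, add_neg_cancel, neg_add_cancel, shiftOp_add, map_one, zpow_one,
    map_mul, hz, map_sub, ht, map_div₀, map_one, map_ofNat]
  congr 1
  ring

theorem zpow_apply_eq (hz : τ z = z) (d : ℤ) : (τ ^ d) z = z := by
  have h : τ ∈ MulAction.stabilizer (K ≃ₐ[k] K) z := hz
  exact (MulAction.stabilizer (K ≃ₐ[k] K) z).zpow_mem h d

theorem commute_zOp (hz : τ z = z) (f : K) (d : ℤ) :
    Commute (shiftOp τ z 0) (shiftOp τ f d) := by
  rw [Commute, SemiconjBy, shiftOp_mul, shiftOp_mul, zpow_apply_eq hz, zero_add, add_zero,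
    zpow_zero, mul_comm f]
  rfl

theorem zpow_neg_apply (ht : τ t = t + 1) (n : ℕ) : (τ ^ (-(n : ℤ))) t = t - n := by
  induction n with
  | zero => simp
  | succ n ih =>
    have h : (τ ^ (-1 : ℤ)) t = t - 1 := by
      rw [zpow_neg_one]
      change τ.symm t = t - 1
      rw [AlgEquiv.symm_apply_eq, map_sub, ht, map_one, add_sub_cancel_right]
    rw [Nat.cast_succ, neg_add, zpow_add, AlgEquiv.mul_apply, h, map_sub, ih, map_one]
    push_cast
    ring

theorem xOp_pow (hz : τ z = z) (ht : τ t = t + 1) (n : ℕ) :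
    shiftOp τ (z * (t - 1 / 2)) (-1) ^ n =
      shiftOp τ (z ^ n * (descPochhammer K n).eval (t - 1 / 2)) (-n) := by
  induction n with
  | zero => simp [shiftOp_one]
  | succ n ih =>
    rw [pow_succ, ih, shiftOp_mul, map_mul, zpow_apply_eq hz, map_sub, zpow_neg_apply ht, map_div₀,
      map_one, map_ofNat, descPochhammer_succ_eval]
    congr 1
    · ring
    · push_cast
      ring

/-- An ordered monomial acts as a single term `f y ^ d`. -/
theorem mono_eq_shiftOp (hz : τ z = z) (ht : τ t = t + 1) (i : ℕ × ℕ × ℕ) :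
    HeisenbergLie.mono (shiftOp τ (z * (t - 1 / 2)) (-1)) (shiftOp τ 1 1) (shiftOp τ z 0) i =
      shiftOp τ (z ^ (i.1 + i.2.1) * (descPochhammer K i.2.1).eval (t - 1 / 2))
        ((i.2.2 : ℤ) - i.2.1) := by
  rw [HeisenbergLie.mono, xOp_pow hz ht, shiftOp_pow_zero, shiftOp_one_pow, shiftOp_mul,
    shiftOp_mul, zpow_zero, map_one]
  congr 1
  · rw [AlgEquiv.one_apply]
    ring
  · ring

/-- `U(H)` acts on Laurent series in `y` with `x` acting as `z (t - 1/2) y⁻¹`. -/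
theorem exists_laurentRep (hz : τ z = z) (ht : τ t = t + 1) :
    ∃ ρ : HeisenbergU k →ₐ[k] Module.End k (LaurentFun K),
      ρ (HeisenbergU.ofLie (HeisenbergLie.x k)) = shiftOp τ (z * (t - 1 / 2)) (-1) ∧
      ρ (HeisenbergU.ofLie (HeisenbergLie.y k)) = shiftOp τ 1 1 ∧
      ρ (HeisenbergU.ofLie (HeisenbergLie.z k)) = shiftOp τ z 0 := by
  have hbr : ⁅(shiftOp τ 1 1 : Module.End k (LaurentFun K)),
      shiftOp τ (z * (t - 1 / 2)) (-1)⁆ = shiftOp τ z 0 := by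
    change shiftOp τ 1 1 * shiftOp τ (z * (t - 1 / 2)) (-1) -
      shiftOp τ (z * (t - 1 / 2)) (-1) * shiftOp τ 1 1 = shiftOp τ z 0
    rw [yOp_mul_xOp hz ht]
    exact add_sub_cancel_left (shiftOp τ (z * (t - 1 / 2)) (-1) * shiftOp τ 1 1) _
  obtain ⟨f, hfx, hfy⟩ := HeisenbergLie.exists_lift (k := k) (L := Module.End k (LaurentFun K))
    (shiftOp τ (z * (t - 1 / 2)) (-1)) (shiftOp τ 1 1)
    (by rw [hbr]; exact sub_eq_zero.2 (commute_zOp hz _ _).eq)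
    (by rw [hbr]; exact sub_eq_zero.2 (commute_zOp hz _ _).eq)
  have hρ : ∀ a, UniversalEnvelopingAlgebra.lift k f (HeisenbergU.ofLie a) = f a :=
    fun a => UniversalEnvelopingAlgebra.lift_ι_apply k f a
  refine ⟨UniversalEnvelopingAlgebra.lift k f, (hρ _).trans hfx, (hρ _).trans hfy, (hρ _).trans ?_⟩
  rw [HeisenbergLie.z]
  refine (LieHom.map_lie f _ _).trans ?_
  rw [hfx, hfy, hbr]

/-- The degree in `y` of an ordered monomial. -/
def monoDeg (i : ℕ × ℕ × ℕ) : ℤ := (i.2.2 : ℤ) - i.2.1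

/-- The coefficient of `y ^ d` in a combination of ordered monomials. -/
def monoCoeff (z t : K) (g : ℕ × ℕ × ℕ →₀ k) (d : ℤ) : K :=
  ∑ i ∈ g.support.filter (fun i => monoDeg i = d),
    g i • (z ^ (i.1 + i.2.1) * (descPochhammer K i.2.1).eval (t - 1 / 2))

theorem monoCoeff_monoDeg_ne_zero (hind : LinearIndependent k
      (fun i : ℕ × ℕ => z ^ i.1 * (descPochhammer K i.2).eval (t - 1 / 2)))
    {g : ℕ × ℕ × ℕ →₀ k} {i : ℕ × ℕ × ℕ} (hi : g i ≠ 0) :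
    monoCoeff z t g (monoDeg i) ≠ 0 := by
  intro hG
  let s : Finset (ℕ × ℕ × ℕ) := g.support.filter (fun j => monoDeg j = monoDeg i)
  have hinj : Set.InjOn (fun j : ℕ × ℕ × ℕ => (j.1 + j.2.1, j.2.1)) (s : Set (ℕ × ℕ × ℕ)) := by
    rintro ⟨a, b, c⟩ h1 ⟨a', b', c'⟩ h2 h
    have h1 := (Finset.mem_filter.1 h1).2
    have h2 := (Finset.mem_filter.1 h2).2
    simp only [monoDeg, Prod.mk.injEq] at h1 h2 h ⊢
    omega
  have hli := (hind.linearIndepOn ((fun j : ℕ × ℕ × ℕ => (j.1 + j.2.1, j.2.1)) '' s)).comp_of_image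
    hinj
  exact hi ((linearIndepOn_finset_iff.1 hli) g hG i
    (Finset.mem_filter.2 ⟨Finsupp.mem_support_iff.2 hi, rfl⟩))

theorem sum_mono_eq_sum_shiftOp (hz : τ z = z) (ht : τ t = t + 1) (g : ℕ × ℕ × ℕ →₀ k) :
    ∑ i ∈ g.support, g i • HeisenbergLie.mono (shiftOp τ (z * (t - 1 / 2)) (-1)) (shiftOp τ 1 1)
        (shiftOp τ z 0) i =
      ∑ d ∈ g.support.image monoDeg, shiftOp τ (monoCoeff z t g d) d := by
  rw [← Finset.sum_fiberwise_of_maps_to (fun i hi => Finset.mem_image_of_mem monoDeg hi)]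
  refine Finset.sum_congr rfl fun d _ => LinearMap.ext fun m => LaurentFun.ext fun n => ?_
  rw [LinearMap.sum_apply, sum_val, shiftOp_val, monoCoeff, Finset.sum_mul]
  refine Finset.sum_congr rfl fun i hi => ?_
  rw [mono_eq_shiftOp hz ht, smul_shiftOp, shiftOp_val, ← (Finset.mem_filter.1 hi).2]
  rfl

/-- Nonzero elements of `U(H)` act bijectively: by the independence of the ordered monomials they
act as nonzero skew Laurent polynomials in `y`. -/
theorem isUnit_laurentRep (hz : τ z = z) (ht : τ t = t + 1)
    (hind : LinearIndependent k
      (fun i : ℕ × ℕ => z ^ i.1 * (descPochhammer K i.2).eval (t - 1 / 2)))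
    {ρ : HeisenbergU k →ₐ[k] Module.End k (LaurentFun K)}
    (hx : ρ (HeisenbergU.ofLie (HeisenbergLie.x k)) = shiftOp τ (z * (t - 1 / 2)) (-1))
    (hy : ρ (HeisenbergU.ofLie (HeisenbergLie.y k)) = shiftOp τ 1 1)
    (hz' : ρ (HeisenbergU.ofLie (HeisenbergLie.z k)) = shiftOp τ z 0)
    {u : HeisenbergU k} (hu : u ≠ 0) : IsUnit (ρ u) := by
  have hmem : u ∈ Submodule.span k (Set.range (HeisenbergLie.mono
      (HeisenbergU.ofLie (HeisenbergLie.x k)) (HeisenbergU.ofLie (HeisenbergLie.y k))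
      (HeisenbergU.ofLie (HeisenbergLie.z k) : HeisenbergU k))) := by
    rw [HeisenbergLie.span_mono (HeisenbergU.y_mul_x k) (HeisenbergU.commute_z_x k)
      (HeisenbergU.commute_z_y k) (HeisenbergU.adjoin_eq_top k)]
    exact Submodule.mem_top
  obtain ⟨g, rfl⟩ := (Finsupp.mem_span_range_iff_exists_finsupp).1 hmem
  obtain ⟨i, hi⟩ : ∃ i, g i ≠ 0 := by
    by_contra! h
    exact hu (by rw [show g = 0 from Finsupp.ext h, Finsupp.sum_zero_index])
  rw [Finsupp.sum, map_sum]
  simp only [map_smul, HeisenbergLie.mono, map_mul, map_pow, hx, hy, hz']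
  have h := sum_mono_eq_sum_shiftOp hz ht g
  simp only [HeisenbergLie.mono] at h
  rw [h]
  exact isUnit_sum_shiftOp _ _ ⟨monoDeg i,
    Finset.mem_image_of_mem monoDeg (Finsupp.mem_support_iff.2 hi),
    monoCoeff_monoDeg_ne_zero hind hi⟩

end Representation

section Extension

variable {k : Type*} [Field k] [CharZero k] {A : Type*} [Ring A] [Algebra k A]

/-- A representation of `U(H)` in which nonzero elements are invertible extends to `𝔇(H)`. -/
theorem exists_extension (ρ : HeisenbergU k →ₐ[k] A) (hρ : ∀ u, u ≠ 0 → IsUnit (ρ u)) :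
    ∃ Θ : HeisenbergD k →ₐ[k] A, ∀ u, Θ (ofU k u) = ρ u := by
  have hunit : ∀ s : (HeisenbergU k)⁰, IsUnit (ρ s) := fun s =>
    hρ _ (nonZeroDivisors.coe_ne_zero s)
  let Θ : HeisenbergD k →+* A := OreLocalization.universalHom (ρ : HeisenbergU k →+* A)
    (IsUnit.liftRight ((ρ : HeisenbergU k →* A).comp (HeisenbergU k)⁰.subtype) hunit)
    (fun _ => rfl)
  have hΘ : ∀ u, Θ (ofU k u) = ρ u := fun u => OreLocalization.universalHom_commutes _ _ _
  exact ⟨{ Θ with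
    commutes' := fun c => by
      refine (hΘ (algebraMap k (HeisenbergU k) c)).trans ?_
      exact ρ.commutes c }, hΘ⟩

end Extension

end HeisenbergD

/-! ### Words in `S` and `T`, and the test vector -/

namespace WordCode

/-- The codes of a word `w` in `S` (the letter `0`) and `T` (the letter `1`). If `(a, l)` is the
first one, then `w S` sends the test vector to `s ^ a • y l`; if `(b, l)` is the second one, then
`c w S` sends it to `s ^ b • y l`. -/
def code : List (Fin 2) → (ℕ × List (Bool × ℕ)) × (ℕ × List (Bool × ℕ))
  | [] => ((1, []), (0, [(true, 0)]))
  | i :: w => if i = 0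
      then (((code w).1.1 + 1, (code w).1.2), (0, (true, (code w).1.1) :: (code w).1.2))
      else ((0, (false, (code w).2.1) :: (code w).2.2), ((code w).2.1 + 1, (code w).2.2))

theorem code_nil : code [] = ((1, []), (0, [(true, 0)])) := rfl

theorem code_zero_cons (w : List (Fin 2)) : code (0 :: w) =
    (((code w).1.1 + 1, (code w).1.2), (0, (true, (code w).1.1) :: (code w).1.2)) := rfl

theorem code_one_cons (w : List (Fin 2)) : code (1 :: w) =
    ((0, (false, (code w).2.1) :: (code w).2.2), ((code w).2.1 + 1, (code w).2.2)) := rfl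

theorem eq_zero_or_one_cons (i : Fin 2) (w : List (Fin 2)) : i :: w = 0 :: w ∨ i :: w = 1 :: w := by
  fin_cases i
  · exact Or.inl rfl
  · exact Or.inr rfl

theorem code_fst_ne (w : List (Fin 2)) (h1 : (code w).1.1 = 0) (h2 : (code w).1.2 = []) :
    False := by
  cases w with
  | nil => simp [code_nil] at h1
  | cons i w =>
    rcases eq_zero_or_one_cons i w with h | h <;> rw [h] at h1 h2
    · simp [code_zero_cons] at h1
    · simp [code_one_cons] at h2

theorem code_inj (w : List (Fin 2)) : ∀ w', ((code w).1 = (code w').1 → w = w') ∧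
    ((code w).2 = (code w').2 → w = w') := by
  induction w with
  | nil =>
    intro w'
    cases w' with
    | nil => exact ⟨fun _ => rfl, fun _ => rfl⟩
    | cons i w' =>
      rcases eq_zero_or_one_cons i w' with h | h <;> rw [h]
      · simp only [code_nil, code_zero_cons, Prod.mk.injEq, List.cons.injEq]
        exact ⟨fun h => (code_fst_ne w' (by omega) h.2.symm).elim,
          fun h => (code_fst_ne w' h.2.1.2.symm h.2.2.symm).elim⟩
      · simp [code_nil, code_one_cons]
  | cons i w ih =>
    intro w'
    cases w' with
    | nil =>
      rcases eq_zero_or_one_cons i w with h | h <;> rw [h]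
      · simp only [code_nil, code_zero_cons, Prod.mk.injEq, List.cons.injEq]
        exact ⟨fun h => (code_fst_ne w (by omega) h.2).elim,
          fun h => (code_fst_ne w h.2.1.2 h.2.2).elim⟩
      · simp [code_nil, code_one_cons]
    | cons j w' =>
      rcases eq_zero_or_one_cons i w with h | h <;> rcases eq_zero_or_one_cons j w' with h' | h' <;>
        rw [h, h']
      · simp only [code_zero_cons, Prod.mk.injEq, List.cons.injEq, true_and,
          Nat.add_right_cancel_iff]
        exact ⟨fun h => (ih w').1 (Prod.ext h.1 h.2), fun h => (ih w').1 (Prod.ext h.1 h.2)⟩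
      · simp [code_zero_cons, code_one_cons]
      · simp [code_zero_cons, code_one_cons]
      · simp only [code_one_cons, Prod.mk.injEq, List.cons.injEq, true_and,
          Nat.add_right_cancel_iff]
        exact ⟨fun h => (ih w').2 (Prod.ext h.1 h.2), fun h => (ih w').2 (Prod.ext h.1 h.2)⟩

end WordCode

namespace LaurentFun

section

variable {k K : Type*} [Field k] [Field K] [Algebra k K]

/-- The Laurent polynomials among the Laurent series. -/
def finite (K : Type*) [Field K] : Submodule K (LaurentFun K) where
  carrier := {m | ∃ N, ∀ n > N, m.1 n = 0}
  add_mem' := by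
    rintro m m' ⟨N, h⟩ ⟨N', h'⟩
    refine ⟨max N N', fun n hn => ?_⟩
    rw [add_val, h n (by omega), h' n (by omega), add_zero]
  zero_mem' := ⟨0, fun _ _ => rfl⟩
  smul_mem' := by
    rintro c m ⟨N, h⟩
    exact ⟨N, fun n hn => by rw [smul_val, h n hn, mul_zero]⟩

variable (τ : K ≃ₐ[k] K) (z : K)

/-- The square of `τ` as a ring homomorphism. -/
def sq : K →+* K := ((τ ^ (2 : ℤ) : K ≃ₐ[k] K) : K →+* K)

theorem sq_apply (f : K) : sq τ f = τ (τ f) := rfl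

/-- The operator `p = z⁻¹ y²` as a semilinear map. -/
def pOp : LaurentFun K →ₛₗ[sq τ] LaurentFun K where
  toFun := shiftOp τ z⁻¹ 2
  map_add' := map_add _
  map_smul' c m := by
    ext n
    rw [shiftOp_val, smul_val, smul_val, shiftOp_val, map_mul]
    exact mul_left_comm _ _ _

theorem pOp_val (m : LaurentFun K) (n : ℤ) : (pOp τ z m).1 n = z⁻¹ * sq τ (m.1 (n - 2)) := rfl

theorem finite_le_comap_pOp : finite K ≤ (finite K).comap (pOp τ z) := by
  rintro m ⟨N, h⟩
  refine ⟨N + 2, fun n hn => ?_⟩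
  rw [pOp_val, h _ (by omega), map_zero, mul_zero]

/-- The operator induced by `p` on Laurent series modulo Laurent polynomials. -/
def pQuot : (LaurentFun K ⧸ finite K) →ₛₗ[sq τ] (LaurentFun K ⧸ finite K) :=
  (finite K).mapQ (finite K) (pOp τ z) (finite_le_comap_pOp τ z)

theorem pQuot_mk (m : LaurentFun K) :
    pQuot τ z ((finite K).mkQ m) = (finite K).mkQ (pOp τ z m) := rfl

/-- The test vector `(1 + y) ∑ pⁿ`, which `p` fixes modulo Laurent polynomials. -/
def testVec : LaurentFun K :=
  ⟨fun n => if 0 ≤ n then z ^ (-(n / 2)) else 0, 0, fun n hn => if_neg (by omega)⟩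

theorem testVec_val (n : ℤ) : (testVec z).1 n = if 0 ≤ n then z ^ (-(n / 2)) else 0 := rfl

variable {z}

theorem testVec_notMem (hz0 : z ≠ 0) : testVec z ∉ finite K := by
  rintro ⟨N, h⟩
  have h1 := h (max 0 (N + 1)) (by omega)
  rw [testVec_val, if_pos (by omega)] at h1
  exact zpow_ne_zero _ hz0 h1

variable {τ}

theorem pOp_testVec_sub_mem (hz : τ z = z) (hz0 : z ≠ 0) :
    pOp τ z (testVec z) - testVec z ∈ finite K := by
  refine ⟨1, fun n hn => ?_⟩
  rw [sub_val, pOp_val, testVec_val, testVec_val, if_pos (by omega), if_pos (by omega),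
    map_zpow₀, sq_apply, hz, hz, sub_eq_zero, show (n - 2) / 2 = n / 2 - 1 by omega, neg_sub,
    sub_eq_add_neg, zpow_add₀ hz0, zpow_one, inv_mul_cancel_left₀ hz0]

end

end LaurentFun

/-! ### The action of `S` and `T` -/

namespace HeisenbergD

open LaurentFun WordCode IteratedSum

theorem lift_basisFreeMonoid {k X A : Type*} [Field k] [Ring A] [Algebra k A] (f : X → A)
    (w : FreeMonoid X) :
    FreeAlgebra.lift k f (FreeAlgebra.basisFreeMonoid k X w) = (w.toList.map f).prod := by
  have h1 : FreeAlgebra.basisFreeMonoid k X w =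
      FreeMonoid.lift (FreeAlgebra.ι k : X → FreeAlgebra k X) w := by
    simp [FreeAlgebra.basisFreeMonoid, FreeAlgebra.equivMonoidAlgebraFreeMonoid]
  rw [h1, ← FreeMonoid.lift_apply]
  refine DFunLike.congr_fun (f := ((FreeAlgebra.lift k f : FreeAlgebra k X →* A)).comp
    (FreeMonoid.lift (FreeAlgebra.ι k))) (FreeMonoid.hom_eq fun x => ?_) w
  simp

section Action

variable {k : Type*} {K : Type*} [Field k] [CharZero k] [Field K] [Algebra k K] {τ : K ≃ₐ[k] K}
  {ζ t : K} {Θ : HeisenbergD k →ₐ[k] Module.End k (LaurentFun K)}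

theorem map_V (hz : τ ζ = ζ) (ht : τ t = t + 1)
    (hx : Θ (x k) = shiftOp τ (ζ * (t - 1 / 2)) (-1)) (hy : Θ (y k) = shiftOp τ 1 1)
    (hz' : Θ (z k) = shiftOp τ ζ 0) : Θ (V k) = shiftOp τ (ζ ^ 3 * t) 0 := by
  have h2 : (2 : K) ≠ 0 := by
    rw [← map_ofNat (algebraMap k K)]
    exact (_root_.map_ne_zero _).2 two_ne_zero
  rw [V, map_smul, map_mul, map_mul, map_add, map_mul, map_mul, hx, hy, hz', yOp_mul_xOp hz ht,
    shiftOp_mul, neg_add_cancel, shiftOp_add, shiftOp_add, shiftOp_mul, shiftOp_mul, smul_shiftOp,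
    Algebra.smul_def]
  simp only [zpow_zero, AlgEquiv.one_apply, map_one, map_div₀, map_ofNat, add_zero]
  congr 1
  field_simp
  ring

theorem map_smul_z_pow (hz' : Θ (z k) = shiftOp τ ζ 0) (c : k) :
    Θ (c • z k ^ 3) = shiftOp τ (ζ ^ 3 * algebraMap k K c) 0 := by
  rw [map_smul, map_pow, hz', shiftOp_pow_zero, smul_shiftOp, Algebra.smul_def, mul_comm]

theorem map_inv_of_shiftOp {d : HeisenbergD k} {f : K} (hf : f ≠ 0) (h : Θ d = shiftOp τ f 0) :
    Θ d⁻¹ = shiftOp τ f⁻¹ 0 := by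
  have hd : d ≠ 0 := by
    rintro rfl
    have h1 := congrArg (fun φ : Module.End k (LaurentFun K) => (φ (single 0 1)).1 0) h
    simp only [map_zero, LinearMap.zero_apply, zero_val, shiftOp_zero_apply, smul_val, single_val,
      if_true, mul_one] at h1
    exact hf h1.symm
  have h1 : Θ d⁻¹ * Θ d = 1 := by rw [← map_mul, inv_mul_cancel₀ hd, map_one]
  have h2 : Θ d * shiftOp τ f⁻¹ 0 = 1 := by
    rw [h, shiftOp_mul, add_zero, zpow_zero, AlgEquiv.one_apply, mul_inv_cancel₀ hf, shiftOp_one]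
  exact left_inv_eq_right_inv h1 h2

/-- `S` acts as a multiplication operator. -/
theorem map_S (hz : τ ζ = ζ) (ht : τ t = t + 1) (hζ : ζ ≠ 0)
    (h1 : t - algebraMap k K (1 / 3) ≠ 0) (h2 : t + algebraMap k K (1 / 3) ≠ 0)
    (hx : Θ (x k) = shiftOp τ (ζ * (t - 1 / 2)) (-1)) (hy : Θ (y k) = shiftOp τ 1 1)
    (hz' : Θ (z k) = shiftOp τ ζ 0) :
    Θ (S k) = shiftOp τ ((t - algebraMap k K (1 / 3)) * (t + algebraMap k K (1 / 3))⁻¹ +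
      (t - algebraMap k K (1 / 3))⁻¹ * (t + algebraMap k K (1 / 3))) 0 := by
  have hsub : Θ (V k - (1 / 3 : k) • z k ^ 3) =
      shiftOp τ (ζ ^ 3 * (t - algebraMap k K (1 / 3))) 0 := by
    rw [map_sub, map_V hz ht hx hy hz', map_smul_z_pow hz', shiftOp_sub, mul_sub]
  have hadd : Θ (V k + (1 / 3 : k) • z k ^ 3) =
      shiftOp τ (ζ ^ 3 * (t + algebraMap k K (1 / 3))) 0 := by
    rw [map_add, map_V hz ht hx hy hz', map_smul_z_pow hz', shiftOp_add, mul_add]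
  have h3 : ζ ^ 3 ≠ 0 := pow_ne_zero _ hζ
  rw [S, map_add, map_mul, map_mul, hsub, hadd, map_inv_of_shiftOp (mul_ne_zero h3 h1) hsub,
    map_inv_of_shiftOp (mul_ne_zero h3 h2) hadd, shiftOp_mul, shiftOp_mul, add_zero, shiftOp_add,
    zpow_zero, AlgEquiv.one_apply, AlgEquiv.one_apply]
  congr 1
  field_simp

theorem map_z_add_y_sq (hζ : ζ ≠ 0) (hy : Θ (y k) = shiftOp τ 1 1) (hz' : Θ (z k) = shiftOp τ ζ 0)
    (m : LaurentFun K) : Θ (z k + y k ^ 2) m = ζ • (m + pOp τ ζ m) := by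
  rw [map_add, map_pow, hy, hz', shiftOp_one_pow, LinearMap.add_apply, shiftOp_zero_apply, smul_add]
  congr 1
  ext n
  rw [shiftOp_val, smul_val, pOp_val, mul_inv_cancel_left₀ hζ, one_mul]
  rfl

theorem map_z_sub_y_sq (hζ : ζ ≠ 0) (hy : Θ (y k) = shiftOp τ 1 1) (hz' : Θ (z k) = shiftOp τ ζ 0)
    (m : LaurentFun K) : Θ (z k - y k ^ 2) m = ζ • (m - pOp τ ζ m) := by
  have h1 := map_z_add_y_sq hζ hy hz' m
  have h2 : Θ (z k) m = ζ • m := by rw [hz', shiftOp_zero_apply]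
  rw [map_add, LinearMap.add_apply, h2, smul_add, add_right_inj] at h1
  rw [map_sub, LinearMap.sub_apply, h1, h2, smul_sub]

end Action

section Nonvanishing

variable {k : Type*} {K : Type*} [Field k] [CharZero k] [Field K] [Algebra k K] {τ : K ≃ₐ[k] K}
  {ζ t : K} {Θ : HeisenbergD k →ₐ[k] Module.End k (LaurentFun K)}

theorem V_sub_ne_zero (hz : τ ζ = ζ) (ht : τ t = t + 1) (hζ : ζ ≠ 0) {c : k}
    (h : t - algebraMap k K c ≠ 0)
    (hx : Θ (x k) = shiftOp τ (ζ * (t - 1 / 2)) (-1)) (hy : Θ (y k) = shiftOp τ 1 1)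
    (hz' : Θ (z k) = shiftOp τ ζ 0) : V k - c • z k ^ 3 ≠ 0 := by
  intro h0
  have h1 := congrArg (fun d => (Θ d (single 0 1)).1 0) h0
  simp only [map_sub, map_V hz ht hx hy hz', map_smul_z_pow hz', shiftOp_sub, map_zero,
    LinearMap.zero_apply, zero_val, shiftOp_zero_apply, smul_val, single_val, if_true, mul_one,
    ← mul_sub] at h1
  exact mul_ne_zero (pow_ne_zero 3 hζ) h h1

theorem z_add_y_sq_ne_zero (hζ : ζ ≠ 0) (hy : Θ (y k) = shiftOp τ 1 1)
    (hz' : Θ (z k) = shiftOp τ ζ 0) : z k + y k ^ 2 ≠ 0 := by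
  intro h0
  have h1 := congrArg (fun d => (Θ d (single 0 1)).1 0) h0
  simp only [map_z_add_y_sq hζ hy hz', map_zero, LinearMap.zero_apply, zero_val, smul_val, add_val,
    pOp_val, single_val] at h1
  simp [hζ] at h1

theorem z_sub_y_sq_ne_zero (hζ : ζ ≠ 0) (hy : Θ (y k) = shiftOp τ 1 1)
    (hz' : Θ (z k) = shiftOp τ ζ 0) : z k - y k ^ 2 ≠ 0 := by
  intro h0
  have h1 := congrArg (fun d => (Θ d (single 0 1)).1 0) h0
  simp only [map_z_sub_y_sq hζ hy hz', map_zero, LinearMap.zero_apply, zero_val, smul_val, sub_val,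
    pOp_val, single_val] at h1
  simp [hζ] at h1

end Nonvanishing

/-! ### Freeness -/

section Freeness

variable (k : Type*) [Field k] [CharZero k]

/-- The element `c = (z + y²) (z - y²)⁻¹`, for which `T = c⁻¹ S c`. -/
def cayley : HeisenbergD k := (z k + y k ^ 2) * (z k - y k ^ 2)⁻¹

/-- The inverse of `cayley`. -/
def cayleyInv : HeisenbergD k := (z k + y k ^ 2)⁻¹ * (z k - y k ^ 2)

theorem commute_z_y : Commute (z k) (y k) := (HeisenbergU.commute_z_y k).map (ofU k)

theorem T_eq : T k = cayleyInv k * S k * cayley k := by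
  simp only [T, cayley, cayleyInv, mul_assoc]

variable {k}

theorem commute_add_sub : Commute (z k + y k ^ 2) (z k - y k ^ 2) := by
  have h := (commute_z_y k).pow_right 2
  exact ((Commute.refl _).sub_right h).add_left (h.symm.sub_right (Commute.refl _))

theorem sub_mul_cayley (hB : z k - y k ^ 2 ≠ 0) :
    (z k - y k ^ 2) * cayley k = z k + y k ^ 2 := by
  rw [cayley, ← mul_assoc, ← commute_add_sub.eq, mul_inv_cancel_right₀ hB]

theorem add_mul_cayleyInv (hA : z k + y k ^ 2 ≠ 0) :
    (z k + y k ^ 2) * cayleyInv k = z k - y k ^ 2 := by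
  rw [cayleyInv, mul_inv_cancel_left₀ hA]

theorem cayley_mul_cayleyInv (hA : z k + y k ^ 2 ≠ 0) (hB : z k - y k ^ 2 ≠ 0) :
    cayley k * cayleyInv k = 1 := by
  refine mul_left_cancel₀ hB ?_
  rw [← mul_assoc, sub_mul_cayley hB, add_mul_cayleyInv hA, mul_one]

variable {K : Type*} [Field K] [Algebra k K] {τ : K ≃ₐ[k] K} {ζ : K}

/-- The iterated sums: a letter `(ε, a)` acts as `c ^ ε s ^ (a + 1)`. -/
def wordVec (Θ : HeisenbergD k →ₐ[k] Module.End k (LaurentFun K)) (s : K) (v : LaurentFun K) :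
    List (Bool × ℕ) → LaurentFun K
  | [] => v
  | l :: w => Θ (if l.1 then cayley k else cayleyInv k) (s ^ (l.2 + 1) • wordVec Θ s v w)

variable {Θ : HeisenbergD k →ₐ[k] Module.End k (LaurentFun K)} {s : K}

theorem wordVec_cons (hζ : ζ ≠ 0) (hy : Θ (y k) = shiftOp τ 1 1) (hz' : Θ (z k) = shiftOp τ ζ 0)
    (v : LaurentFun K) (l : Bool × ℕ) (w : List (Bool × ℕ)) :
    wordVec Θ s v (l :: w) - sgn K l.1 • pOp τ ζ (wordVec Θ s v (l :: w)) =
      s ^ (l.2 + 1) • wordVec Θ s v w + sgn K l.1 • pOp τ ζ (s ^ (l.2 + 1) • wordVec Θ s v w) := by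
  have hA := z_add_y_sq_ne_zero hζ hy hz'
  have hB := z_sub_y_sq_ne_zero hζ hy hz'
  refine smul_right_injective (LaurentFun K) hζ ?_
  obtain ⟨b, a⟩ := l
  cases b
  · have h := congrArg (fun d => Θ d (s ^ (a + 1) • wordVec Θ s v w)) (add_mul_cayleyInv hA)
    simp only [map_mul, Module.End.mul_apply, map_z_add_y_sq hζ hy hz',
      map_z_sub_y_sq hζ hy hz'] at h
    change ζ • (Θ (cayleyInv k) (s ^ (a + 1) • wordVec Θ s v w) -
      (-1 : K) • pOp τ ζ (Θ (cayleyInv k) (s ^ (a + 1) • wordVec Θ s v w))) =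
      ζ • (s ^ (a + 1) • wordVec Θ s v w + (-1 : K) • pOp τ ζ (s ^ (a + 1) • wordVec Θ s v w))
    have hn : ∀ m : LaurentFun K, (-1 : K) • m = -m := fun m => neg_one_smul K m
    rwa [hn, hn, sub_neg_eq_add, ← sub_eq_add_neg]
  · have h := congrArg (fun d => Θ d (s ^ (a + 1) • wordVec Θ s v w)) (sub_mul_cayley hB)
    simp only [map_mul, Module.End.mul_apply, map_z_add_y_sq hζ hy hz',
      map_z_sub_y_sq hζ hy hz'] at h
    simpa [sgn, wordVec] using h

theorem linearIndependent_wordVec (hz : τ ζ = ζ) (hζ : ζ ≠ 0) (hy : Θ (y k) = shiftOp τ 1 1)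
    (hz' : Θ (z k) = shiftOp τ ζ 0) (hneg : ∀ f, τ (τ f) = -f → f = 0)
    (hsum : ∀ (c : ℕ →₀ K) (b : Bool) (f : K), (∀ a, τ (τ (c a)) = c a) →
      τ (τ f) = sgn K b * f + c.sum (fun a r => r * s ^ (a + 1)) → c = 0) :
    LinearIndependent K (fun w => (finite K).mkQ (wordVec Θ s (testVec ζ) w)) := by
  have h2 : (2 : K) ≠ 0 := by
    rw [← map_ofNat (algebraMap k K)]
    exact (_root_.map_ne_zero _).2 two_ne_zero
  refine linearIndependent_words (p := pQuot τ ζ) (s := s) ?_ ?_ ?_ h2 hneg hsum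
  · rw [pQuot_mk, ← sub_eq_zero, ← map_sub, Submodule.mkQ_apply, Submodule.Quotient.mk_eq_zero]
    exact pOp_testVec_sub_mem hz hζ
  · rw [Submodule.mkQ_apply, Ne, Submodule.Quotient.mk_eq_zero]
    exact testVec_notMem hζ
  · intro l w
    have h := congrArg (finite K).mkQ (wordVec_cons (s := s) hζ hy hz' (testVec ζ) l w)
    simpa only [map_sub, map_add, map_smul, ← pQuot_mk] using h

/-- Applied to the test vector, a word in `S` and `T` followed by `S` gives a power of `s` times an
iterated sum. -/
theorem map_word_apply (hA : z k + y k ^ 2 ≠ 0) (hB : z k - y k ^ 2 ≠ 0)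
    (hS : Θ (S k) = shiftOp τ s 0) (v : LaurentFun K) (w : List (Fin 2)) :
    Θ ((w.map ![S k, T k]).prod * S k) v = s ^ (code w).1.1 • wordVec Θ s v (code w).1.2 ∧
      Θ (cayley k * ((w.map ![S k, T k]).prod * S k)) v =
        s ^ (code w).2.1 • wordVec Θ s v (code w).2.2 := by
  induction w with
  | nil =>
    rw [List.map_nil, List.prod_nil, one_mul, map_mul, Module.End.mul_apply, hS,
      shiftOp_zero_apply, code_nil]
    simp [wordVec]
  | cons i w ih =>
    rcases eq_zero_or_one_cons i w with h | h <;> rw [h]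
    · have h0 : Θ ((List.map ![S k, T k] (0 :: w)).prod * S k) v =
          s ^ ((code w).1.1 + 1) • wordVec Θ s v (code w).1.2 := by
        rw [List.map_cons, List.prod_cons, mul_assoc, map_mul, Module.End.mul_apply, ih.1]
        change Θ (S k) _ = _
        rw [hS, shiftOp_zero_apply, smul_smul, ← pow_succ']
      refine ⟨h0, ?_⟩
      rw [map_mul, Module.End.mul_apply, h0, code_zero_cons, pow_zero, one_smul]
      rfl
    · have h1 : Θ (S k * (cayley k * ((List.map ![S k, T k] w).prod * S k))) v =
          s ^ ((code w).2.1 + 1) • wordVec Θ s v (code w).2.2 := by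
        rw [map_mul, Module.End.mul_apply, ih.2, hS, shiftOp_zero_apply, smul_smul, ← pow_succ']
      have h2 : (List.map ![S k, T k] (1 :: w)).prod * S k =
          cayleyInv k * (S k * (cayley k * ((List.map ![S k, T k] w).prod * S k))) := by
        rw [List.map_cons, List.prod_cons]
        change T k * _ * _ = _
        rw [T_eq]
        simp only [mul_assoc]
      rw [h2]
      constructor
      · rw [map_mul, Module.End.mul_apply, h1, code_one_cons, pow_zero, one_smul]
        rfl
      · rw [← mul_assoc, cayley_mul_cayleyInv hA hB, one_mul, h1, code_one_cons]

/-- The freeness criterion: the words in `S` and `T`, followed by `S` and applied to the test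
vector, are independent modulo Laurent polynomials. -/
theorem injective_lift (hA : z k + y k ^ 2 ≠ 0) (hB : z k - y k ^ 2 ≠ 0)
    (hS : Θ (S k) = shiftOp τ s 0) (hpow : LinearIndependent k (fun n : ℕ => s ^ n))
    {v : LaurentFun K}
    (hli : LinearIndependent K (fun w => (finite K).mkQ (wordVec Θ s v w))) :
    Function.Injective (FreeAlgebra.lift k ![S k, T k] :
      FreeAlgebra k (Fin 2) →ₐ[k] HeisenbergD k) := by
  let G : HeisenbergD k →ₗ[k] (LaurentFun K ⧸ finite K) :=
    ((finite K).mkQ.restrictScalars k).comp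
      ((LinearMap.applyₗ v).comp (Θ.toLinearMap.comp (LinearMap.mulRight k (S k))))
  have hG : ∀ d, G d = (finite K).mkQ (Θ (d * S k) v) := fun d => rfl
  let b := FreeAlgebra.basisFreeMonoid k (Fin 2)
  have hb : ∀ w : FreeMonoid (Fin 2), G (FreeAlgebra.lift k ![S k, T k] (b w)) =
      s ^ (code w.toList).1.1 • (finite K).mkQ (wordVec Θ s v (code w.toList).1.2) := by
    intro w
    rw [hG, lift_basisFreeMonoid, (map_word_apply hA hB hS v _).1, map_smul]
  have hind : LinearIndependent k fun w => G (FreeAlgebra.lift k ![S k, T k] (b w)) := by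
    simp only [hb]
    exact (linearIndependent_smul hpow hli).comp
      (fun w : FreeMonoid (Fin 2) => (code w.toList).1) fun w w' h => (code_inj _ _).1 h
  refine (injective_iff_map_eq_zero _).2 fun P hP => ?_
  have h := linearIndependent_iff.1 hind (b.repr P) (by
    have h1 := Finsupp.apply_linearCombination k
      (G.comp (FreeAlgebra.lift k ![S k, T k]).toLinearMap) b (b.repr P)
    rw [b.linearCombination_repr] at h1
    refine h1.symm.trans ?_
    rw [LinearMap.comp_apply, AlgHom.toLinearMap_apply, hP, map_zero])
  exact b.repr.map_eq_zero_iff.1 h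

end Freeness

/-! ### The principal involution -/

section Involution

variable (k : Type*) [Field k] [CharZero k]

/-- The principal involution as a map from `𝔇(H)` to itself. -/
def adj (d : HeisenbergD k) : HeisenbergD k := (principalInvolution k d).unop

variable {k}

theorem adj_mul (a b : HeisenbergD k) : adj k (a * b) = adj k b * adj k a := by
  simp [adj]

theorem adj_add (a b : HeisenbergD k) : adj k (a + b) = adj k a + adj k b := by
  simp [adj]

theorem adj_sub (a b : HeisenbergD k) : adj k (a - b) = adj k a - adj k b := by
  simp [adj]

theorem adj_inv (a : HeisenbergD k) : adj k a⁻¹ = (adj k a)⁻¹ := by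
  rw [adj, map_inv₀]
  rfl

theorem adj_pow (a : HeisenbergD k) (n : ℕ) : adj k (a ^ n) = adj k a ^ n := by
  simp [adj]

theorem adj_smul (c : k) (a : HeisenbergD k) : adj k (c • a) = c • adj k a := by
  simp [adj]

theorem adj_x : adj k (x k) = -x k := congrArg MulOpposite.unop (principalInvolution_ofLie k _)

theorem adj_y : adj k (y k) = -y k := congrArg MulOpposite.unop (principalInvolution_ofLie k _)

theorem adj_z : adj k (z k) = -z k := congrArg MulOpposite.unop (principalInvolution_ofLie k _)

theorem adj_V : adj k (V k) = V k := by
  simp only [V, adj_smul, adj_mul, adj_add, adj_x, adj_y, adj_z]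
  congr 1
  noncomm_ring

theorem adj_S : adj k (S k) = S k := by
  have h : adj k (z k ^ 3) = -z k ^ 3 := by rw [adj_pow, adj_z, Odd.neg_pow (by decide)]
  simp only [S, adj_add, adj_sub, adj_mul, adj_inv, adj_smul, adj_V, h, smul_neg, sub_neg_eq_add,
    ← sub_eq_add_neg]
  exact add_comm _ _

theorem adj_T : adj k (T k) = T k := by
  have h : adj k (y k ^ 2) = y k ^ 2 := by rw [adj_pow, adj_y, neg_sq]
  have hA : adj k (z k + y k ^ 2) = -(z k - y k ^ 2) := by
    rw [adj_add, adj_z, h, neg_sub, sub_eq_neg_add]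
  have hB : adj k (z k - y k ^ 2) = -(z k + y k ^ 2) := by
    rw [adj_sub, adj_z, h, neg_add, sub_eq_add_neg]
  rw [T, adj_mul, adj_mul, adj_mul, adj_mul, adj_inv, adj_inv, adj_S, hA, hB, inv_neg, inv_neg]
  simp only [neg_mul, mul_neg, neg_neg, mul_assoc]

end Involution

/-! ### The field `k(z)(t)` -/

open ShiftField in
theorem ne_zero_and_injective_lift (k : Type*) [Field k] [CharZero k] :
    (V k - (1 / 3 : k) • z k ^ 3 ≠ 0 ∧ V k + (1 / 3 : k) • z k ^ 3 ≠ 0 ∧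
      z k + y k ^ 2 ≠ 0 ∧ z k - y k ^ 2 ≠ 0) ∧
    Function.Injective (FreeAlgebra.lift k ![S k, T k] :
      FreeAlgebra k (Fin 2) →ₐ[k] HeisenbergD k) := by
  -- `z` is the variable of the inner field `F = k(z)`, and `t` that of the outer field `K = F(t)`
  let F := RatFunc k
  let K := RatFunc F
  let τ : K ≃ₐ[k] K := (shift F).restrictScalars k
  let ζ : K := algebraMap F K RatFunc.X
  let t : K := RatFunc.X
  have hz : τ ζ = ζ := (shift F).commutes _
  have ht : τ t = t + 1 := shift_X F
  have hζ : ζ ≠ 0 := (_root_.map_ne_zero _).2 RatFunc.X_ne_zero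
  have hk : ∀ c : k, algebraMap k K c = algebraMap F K (algebraMap k F c) :=
    IsScalarTower.algebraMap_apply k F K
  have hthird : algebraMap k K (1 / 3) = algebraMap F K (1 / 3) := by
    rw [hk, map_div₀, map_one, map_ofNat]
  have h1 : t - algebraMap k K (1 / 3) ≠ 0 := hthird ▸ X_sub_C_ne_zero _
  have h2 : t + algebraMap k K (1 / 3) ≠ 0 := hthird ▸ X_add_C_ne_zero _
  have hind : LinearIndependent k
      (fun i : ℕ × ℕ => ζ ^ i.1 * (descPochhammer K i.2).eval (t - 1 / 2)) := by
    have h := linearIndependent_smul (linearIndependent_X_pow k)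
      (linearIndependent_descPochhammer (F := F))
    simpa only [Algebra.smul_def, map_pow, map_div₀, map_one, map_ofNat] using h
  obtain ⟨ρ, hx, hy, hzρ⟩ := exists_laurentRep (k := k) hz ht
  obtain ⟨Θ, hΘ⟩ := exists_extension (k := k) (A := Module.End k (LaurentFun K)) ρ
    fun u hu => isUnit_laurentRep hz ht hind hx hy hzρ hu
  have hx' := (hΘ _).trans hx
  have hy' := (hΘ _).trans hy
  have hz' := (hΘ _).trans hzρ
  have hA := z_add_y_sq_ne_zero hζ hy' hz'
  have hB := z_sub_y_sq_ne_zero hζ hy' hz'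
  have hS : Θ (S k) = shiftOp τ (sFun F) 0 := by
    rw [map_S hz ht hζ h1 h2 hx' hy' hz', hthird]
    rfl
  refine ⟨⟨V_sub_ne_zero hz ht hζ h1 hx' hy' hz', ?_, hA, hB⟩, ?_⟩
  · have h := V_sub_ne_zero (c := -(1 / 3 : k)) hz ht hζ
      (by rwa [map_neg, sub_neg_eq_add]) hx' hy' hz'
    rwa [neg_smul, sub_neg_eq_add] at h
  · have hpole : sFun F ∉ regularInOrbit F 0 := by
      rw [regularInOrbit_zero]
      exact sFun_notMem_regularAt
    have hzero : (sFun F)⁻¹ ∈ regularInOrbit F 0 := by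
      rw [regularInOrbit_zero]
      exact inv_sFun_mem_regularAt
    refine injective_lift hA hB hS (IteratedSum.linearIndependent_pow_of_notMem
      (fun r => ?_) hpole hzero)
      (linearIndependent_wordVec hz hζ hy' hz' (fun f hf => eq_zero_of_shift_shift_eq_neg hf)
        fun c b f hc hf => IteratedSum.eq_zero_of_map_eq (σ := sq τ) (O := regularInOrbit F)
          shift_shift_mem_regularInOrbit finite_notMem_regularInOrbit hpole hzero
          sFun_mem_regularInOrbit c b f hc hf)
    rw [hk]
    exact algebraMap_mem_regularAt _ _

end HeisenbergD

end

theorem mainTheorem4 (k : Type*) [Field k] [CharZero k] :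
    -- the four elements that are inverted in the definitions of `S` and `T` are nonzero
    (HeisenbergD.V k - (1 / 3 : k) • HeisenbergD.z k ^ 3 ≠ 0 ∧
      HeisenbergD.V k + (1 / 3 : k) • HeisenbergD.z k ^ 3 ≠ 0 ∧
      HeisenbergD.z k + HeisenbergD.y k ^ 2 ≠ 0 ∧
      HeisenbergD.z k - HeisenbergD.y k ^ 2 ≠ 0) ∧
    -- the subalgebra generated by `S` and `T` is free on `S` and `T`
    Function.Injective (FreeAlgebra.lift k ![HeisenbergD.S k, HeisenbergD.T k] :
      FreeAlgebra k (Fin 2) →ₐ[k] HeisenbergD k) ∧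
    -- `S` and `T` are symmetric
    (HeisenbergD.principalInvolution k (HeisenbergD.S k) = MulOpposite.op (HeisenbergD.S k) ∧
      HeisenbergD.principalInvolution k (HeisenbergD.T k) =
        MulOpposite.op (HeisenbergD.T k)) := by
  obtain ⟨hne, hinj⟩ := HeisenbergD.ne_zero_and_injective_lift k
  exact ⟨hne, hinj, congrArg MulOpposite.op HeisenbergD.adj_S,
    congrArg MulOpposite.op HeisenbergD.adj_T⟩
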